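/- Let $\mathcal L$ be the twisted Heisenberg–Virasoro algebra, i.e. the complex Lie algebra with basis $L(m), I(m)$ $(m\in\mathbb Z)$, $C_L, C_I, C_{LI}$ and brackets $[L(m),L(n)]=(n-m)L(m+n)+\delta_{m+n,0}\frac{m^3-m}{12}C_L$, $[I(m),I(n)]=n\,\delta_{m+n,0}C_I$, $[L(m),I(n)]=nI(m+n)+\delta_{m+n,0}(m^2-m)C_{LI}$, with $C_L,C_I,C_{LI}$ central. A Harish-Chandra module over $\mathcal L$ is a nonzero indecomposable $\mathcal L$-module $V$ that is the direct sum of the eigenspaces (weight spaces) of $L(0)$, all of them finite-dimensional. It is of the intermediate series if moreover $\mathcal L$ does not act by zero and every weight space is at most one-dimensional. Consider the following modules, each with basis $v_t$ $(t\in\mathbb Z)$ and with $C_L,C_I,C_{LI}$ acting by $0$: 1. $\mathcal A_{a,b,c}$ $(a,b,c\in\mathbb C)$: $L(n)v_t=(a+t+bn)v_{n+t}$, $I(n)v_t=cv_{n+t}$. 2. $\mathcal A(a,d)$ $(a,d\in\mathbb C)$: $L(n)v_t=(t+n)v_{n+t}$ and $I(n)v_t=0$ if $t\ne0$; $L(n)v_0=n(n+a)v_n$,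 $I(n)v_0=dn\,v_n$. 3. $\mathcal B(a,d)$ $(a,d\in\mathbb C)$: $L(n)v_t=tv_{n+t}$ and $I(n)v_t=0$ if $n+t\ne0$; $L(n)v_{-n}=-n(n+a)v_0$, $I(n)v_{-n}=dn\,v_0$. 4. $\mathcal U_d$ $(d\in\mathbb C)$: $L(n)v_t=tv_{n+t}$; $I(n)v_t=0$ if $n+t\ne0$, $I(n)v_{-n}=nd\,v_0$. 5. $\mathcal V_d$ $(d\in\mathbb C)$: $L(n)v_t=(t+n)v_{n+t}$; $I(n)v_t=0$ if $t\ne0$, $I(n)v_0=nd\,v_n$. 6. $\tilde{\mathcal U}_d$ $(d\in\mathbb C\setminus\{0\})$: $L(n)v_t=tv_{n+t}$ and $I(n)v_t=0$ if $n+t\neq0$; $L(n)v_{-n}=0$, $I(n)v_{-n}=dn\,v_0$. 7. $\tilde{\mathcal V}_c$ $(c\in\mathbb C\setminus\{0\})$: $L(n)v_t=tv_{n+t}$ if $n+t\ne0$, $L(n)v_{-n}=0$; $I(n)v_0=cv_n$ if $n\ne0$, and $I(n)v_t=0$ if $t\ne0$ or $n=t=0$. Let $V$ be a Harish-Chandra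 module of the intermediate series over $\mathcal L$. If $V$ is irreducible, then $V$ is isomorphic to an irreducible module among the modules 1–7, or to a nontrivial simple subquotient of one of the modules 1–7 (a subquotient is $N/P$ with $P\subseteq N$ submodules; nontrivial means that $\mathcal L$ does not act by zero). If $V$ is not irreducible, then $V$ is isomorphic to one of the modules 1–7. -/

import Mathlib

noncomputable section

namespace TwistedHV

/-- Indices of the standard basis `L(m), I(m), C_L, C_I, C_{LI}` (`m ∈ ℤ`). -/
inductive Gen : Type
  | L (m : ℤ)
  | I (m : ℤ)
  | CL
  | CI
  | CLI

/-- The twisted Heisenberg–Virasoro algebra over `ℂ`: the complex vector space with basis `Gen`. -/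
def Alg : Type := Gen →₀ ℂ

instance : AddCommGroup Alg := inferInstanceAs (AddCommGroup (Gen →₀ ℂ))
instance : Module ℂ Alg := inferInstanceAs (Module ℂ (Gen →₀ ℂ))

/-- `z` times the basis vector with index `g`. -/
def mono (g : Gen) (z : ℂ) : Alg := Finsupp.single g z

/-- The defining brackets of basis vectors. -/
def bracketGen : Gen → Gen → Alg
  | .L m, .L n => mono (.L (m + n)) ((n : ℂ) - m)
      + mono .CL (if m + n = 0 then ((m : ℂ) ^ 3 - m) / 12 else 0)
  | .I m, .I n => mono .CI (if m + n = 0 then (n : ℂ) else 0)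
  | .L m, .I n => mono (.I (m + n)) (n : ℂ)
      + mono .CLI (if m + n = 0 then (m : ℂ) ^ 2 - m else 0)
  | .I n, .L m => -(mono (.I (m + n)) (n : ℂ)
      + mono .CLI (if m + n = 0 then (m : ℂ) ^ 2 - m else 0))
  | _, _ => 0

/-- The bilinear extension of `bracketGen`. -/
def bracketHom : Alg →ₗ[ℂ] Alg →ₗ[ℂ] Alg :=
  Finsupp.linearCombination ℂ fun x : Gen =>
    (Finsupp.linearCombination ℂ (bracketGen x) : (Gen →₀ ℂ) →ₗ[ℂ] Alg)

instance : Bracket Alg Alg := ⟨fun x y => bracketHom x y⟩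

theorem lie_def (x y : Alg) : ⁅x, y⁆ = bracketHom x y := rfl

theorem lie_mono (x y : Gen) (a b : ℂ) : ⁅mono x a, mono y b⁆ = (a * b) • bracketGen x y := by
  have h : bracketHom (mono x a)
      = a • (Finsupp.linearCombination ℂ (bracketGen x) : (Gen →₀ ℂ) →ₗ[ℂ] Alg) :=
    Finsupp.linearCombination_single ℂ a x
  have h' : (Finsupp.linearCombination ℂ (bracketGen x) : (Gen →₀ ℂ) →ₗ[ℂ] Alg)
      (Finsupp.single y b) = b • bracketGen x y :=
    Finsupp.linearCombination_single ℂ b y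
  have h'' : bracketHom (mono x a) (mono y b) = a • (b • bracketGen x y) := by
    rw [h, ← h']; rfl
  rw [lie_def, h'', smul_smul]

theorem smul_mono (a b : ℂ) (x : Gen) : a • mono x b = mono x (a * b) :=
  Finsupp.smul_single a x b

theorem mono_add (x : Gen) (a b : ℂ) : mono x (a + b) = mono x a + mono x b :=
  Finsupp.single_add x a b

theorem mono_zero (x : Gen) : mono x 0 = 0 := Finsupp.single_zero x

theorem mono_neg (x : Gen) (a : ℂ) : mono x (-a) = -mono x a := Finsupp.single_neg x a

theorem alg_induction {p : Alg → Prop} (x : Alg) (h0 : p 0)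
    (ha : ∀ x y, p x → p y → p (x + y)) (hs : ∀ g z, p (mono g z)) : p x :=
  Finsupp.induction_linear x h0 ha hs

theorem add_lie' (x y z : Alg) : ⁅x + y, z⁆ = ⁅x, z⁆ + ⁅y, z⁆ := by simp [lie_def]
theorem lie_add' (x y z : Alg) : ⁅x, y + z⁆ = ⁅x, y⁆ + ⁅x, z⁆ := by simp [lie_def]
theorem zero_lie' (z : Alg) : ⁅(0 : Alg), z⁆ = 0 := by simp [lie_def]
theorem lie_zero' (z : Alg) : ⁅z, (0 : Alg)⁆ = 0 := by simp [lie_def]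
theorem smul_lie' (a : ℂ) (x z : Alg) : ⁅a • x, z⁆ = a • ⁅x, z⁆ := by simp [lie_def]
theorem lie_smul' (a : ℂ) (x z : Alg) : ⁅x, a • z⁆ = a • ⁅x, z⁆ := by simp [lie_def]
theorem neg_lie' (x z : Alg) : ⁅-x, z⁆ = -⁅x, z⁆ := by simp [lie_def]
theorem lie_neg' (x z : Alg) : ⁅x, -z⁆ = -⁅x, z⁆ := by simp [lie_def]

theorem bracketGen_antisymm (x y : Gen) : bracketGen x y = -bracketGen y x := by
  rcases x with m | m | _ | _ | _ <;> rcases y with n | n | _ | _ | _ <;>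
    simp only [bracketGen, neg_zero, neg_neg, neg_add_rev, ← mono_neg]
  · rw [add_comm n m, add_comm (mono Gen.CL _)]
    congr 2
    · ring
    · split_ifs with h
      · obtain rfl : n = -m := by lia
        push_cast; ring
      · simp
  · rw [add_comm n m]
    congr 1
    split_ifs with h
    · obtain rfl : n = -m := by lia
      simp
    · simp

theorem lie_antisymm (x y : Alg) : ⁅x, y⁆ = -⁅y, x⁆ := by
  induction x using alg_induction with
  | h0 => simp [zero_lie', lie_zero']
  | ha a b h1 h2 => rw [add_lie', lie_add', h1, h2, neg_add]
  | hs g z =>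
    induction y using alg_induction with
    | h0 => simp [zero_lie', lie_zero']
    | ha a b h1 h2 => rw [add_lie', lie_add', h1, h2, neg_add]
    | hs g' z' => rw [lie_mono, lie_mono, bracketGen_antisymm g g', mul_comm, smul_neg]

theorem jacobi_gen (x y z : Gen) (a b c : ℂ) :
    ⁅mono x a, ⁅mono y b, mono z c⁆⁆
      = ⁅⁅mono x a, mono y b⁆, mono z c⁆ + ⁅mono y b, ⁅mono x a, mono z c⁆⁆ := by
  rcases x with l | l | _ | _ | _ <;> rcases y with m | m | _ | _ | _ <;>
    rcases z with n | n | _ | _ | _ <;>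
    simp only [lie_mono, bracketGen, lie_smul', smul_lie', lie_add', add_lie', lie_neg', neg_lie',
      lie_zero', zero_lie', smul_zero, smul_add, smul_neg, smul_mono, add_zero, zero_add, neg_zero,
      mul_zero, zero_mul, neg_neg, neg_add_rev]
  · rw [show m + (l + n) = l + (m + n) by ring, show l + m + n = l + (m + n) by ring]
    by_cases h : l + (m + n) = 0
    · obtain rfl : l = -(m + n) := by lia
      simp only [h, if_true]
      rw [add_add_add_comm, ← mono_add, ← mono_add]
      congr 2 <;> push_cast <;> ring
    · simp only [h, if_false, mul_zero, mono_zero, add_zero]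
      rw [← mono_add]
      congr 1; push_cast; ring
  · rw [show m + (l + n) = l + (m + n) by ring, show l + m + n = l + (m + n) by ring]
    by_cases h : l + (m + n) = 0
    · obtain rfl : l = -(m + n) := by lia
      simp only [h, if_true]
      rw [add_add_add_comm, ← mono_add, ← mono_add]
      congr 2 <;> push_cast <;> ring
    · simp only [h, if_false, mul_zero, mono_zero, add_zero]
      rw [← mono_add]
      congr 1; push_cast; ring
  · rw [show n + (l + m) = l + (n + m) by ring, show l + n + m = l + (n + m) by ring]
    simp only [← mono_neg]
    rw [add_add_add_comm, ← mono_add, ← mono_add]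
    by_cases h : l + (n + m) = 0
    · obtain rfl : l = -(n + m) := by lia
      simp only [h, if_true]
      congr 2 <;> push_cast <;> ring
    · simp only [h, if_false, mul_zero, neg_zero, mono_zero, zero_add, add_zero]
      congr 1; push_cast; ring
  · rw [show m + (l + n) = l + m + n by ring, ← mono_add]
    by_cases h : l + m + n = 0
    · obtain rfl : l = -(m + n) := by lia
      simp only [h, if_true]
      rw [← mono_zero Gen.CI]
      congr 1; push_cast; ring
    · simp [h, mono_zero]
  · rw [show n + (m + l) = m + n + l by ring, show m + (n + l) = m + n + l by ring]
    simp only [← mono_neg]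
    rw [add_comm (mono (Gen.I _) (a * b * l * c * _)), add_add_add_comm, ← mono_add, ← mono_add]
    by_cases h : m + n + l = 0
    · obtain rfl : l = -(m + n) := by lia
      simp only [h, if_true]
      congr 2 <;> push_cast <;> ring
    · simp only [h, if_false, mul_zero, neg_zero, mono_zero, zero_add, add_zero]
      congr 1; push_cast; ring
  · rw [show m + l + n = l + (m + n) by ring, ← mono_neg]
    by_cases h : l + (m + n) = 0
    · obtain rfl : l = -(m + n) := by lia
      simp only [h, if_true]
      congr 1; push_cast; ring
    · simp [h, mono_zero]
  · rw [show m + (n + l) = l + (n + m) by ring]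
    by_cases h : l + (n + m) = 0
    · obtain rfl : l = -(n + m) := by lia
      simp only [h, if_true]
      congr 2; push_cast; ring
    · simp [h, mono_zero]

theorem jacobi (x y z : Alg) : ⁅x, ⁅y, z⁆⁆ = ⁅⁅x, y⁆, z⁆ + ⁅y, ⁅x, z⁆⁆ := by
  induction x using alg_induction with
  | h0 => simp [zero_lie', lie_zero']
  | ha a b h1 h2 => simp only [add_lie', lie_add', h1, h2]; abel
  | hs g u =>
    induction y using alg_induction with
    | h0 => simp [zero_lie', lie_zero']
    | ha a b h1 h2 => simp only [add_lie', lie_add', h1, h2]; abel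
    | hs g' u' =>
      induction z using alg_induction with
      | h0 => simp [lie_zero']
      | ha a b h1 h2 => simp only [lie_add', h1, h2]; abel
      | hs g'' u'' => exact jacobi_gen g g' g'' u u' u''

instance : LieRing Alg where
  add_lie := add_lie'
  lie_add := lie_add'
  lie_self x := by
    have h := lie_antisymm x x
    have h2 : (2 : ℂ) • ⁅x, x⁆ = 0 := by rw [two_smul]; nth_rewrite 1 [h]; simp
    exact (smul_eq_zero.mp h2).resolve_left two_ne_zero
  leibniz_lie := jacobi

instance : LieAlgebra ℂ Alg where
  lie_smul := lie_smul'

/-- Structure constants of a `ℤ`-graded module with basis `v_t` (`t ∈ ℤ`) on which the centre acts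
by zero: `L(n) v_t = ℓ n t • v_{n+t}` and `I(n) v_t = f n t • v_{n+t}`, together with the identities
saying that this is a module. -/
structure Coeffs where
  ℓ : ℤ → ℤ → ℂ
  f : ℤ → ℤ → ℂ
  LL : ∀ m n t, ℓ m (n + t) * ℓ n t - ℓ n (m + t) * ℓ m t = ((n : ℂ) - m) * ℓ (m + n) t
  LI : ∀ m n t, ℓ m (n + t) * f n t - f n (m + t) * ℓ m t = (n : ℂ) * f (m + n) t
  II : ∀ m n t, f m (n + t) * f n t = f n (m + t) * f m t

/-- The vector space with basis `v_t`, `t ∈ ℤ`, underlying the module given by `C`. -/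
def Mod (_C : Coeffs) : Type := ℤ →₀ ℂ

section

variable (C : Coeffs)

instance : AddCommGroup (Mod C) := inferInstanceAs (AddCommGroup (ℤ →₀ ℂ))
instance : Module ℂ (Mod C) := inferInstanceAs (Module ℂ (ℤ →₀ ℂ))

/-- `z • v_t`. -/
def vec (t : ℤ) (z : ℂ) : Mod C := Finsupp.single t z

/-- The action of a basis element of the algebra on `v_t`. -/
def actGen : Gen → ℤ → Mod C
  | .L n, t => vec C (n + t) (C.ℓ n t)
  | .I n, t => vec C (n + t) (C.f n t)
  | .CL, _ => 0
  | .CI, _ => 0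
  | .CLI, _ => 0

/-- The bilinear extension of `actGen`. -/
def actHom : Alg →ₗ[ℂ] Mod C →ₗ[ℂ] Mod C :=
  Finsupp.linearCombination ℂ fun x : Gen =>
    (Finsupp.linearCombination ℂ (actGen C x) : (ℤ →₀ ℂ) →ₗ[ℂ] Mod C)

instance : Bracket Alg (Mod C) := ⟨fun x v => actHom C x v⟩

theorem act_def (x : Alg) (v : Mod C) : ⁅x, v⁆ = actHom C x v := rfl

theorem act_mono (x : Gen) (t : ℤ) (a b : ℂ) : ⁅mono x a, vec C t b⁆ = (a * b) • actGen C x t := by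
  have h : actHom C (mono x a)
      = a • (Finsupp.linearCombination ℂ (actGen C x) : (ℤ →₀ ℂ) →ₗ[ℂ] Mod C) :=
    Finsupp.linearCombination_single ℂ a x
  have h' : (Finsupp.linearCombination ℂ (actGen C x) : (ℤ →₀ ℂ) →ₗ[ℂ] Mod C)
      (Finsupp.single t b) = b • actGen C x t :=
    Finsupp.linearCombination_single ℂ b t
  have h'' : actHom C (mono x a) (vec C t b) = a • (b • actGen C x t) := by
    rw [h, ← h']; rfl
  rw [act_def, h'', smul_smul]

theorem smul_vec (a b : ℂ) (t : ℤ) : a • vec C t b = vec C t (a * b) :=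
  Finsupp.smul_single a t b

theorem vec_add (t : ℤ) (a b : ℂ) : vec C t (a + b) = vec C t a + vec C t b :=
  Finsupp.single_add t a b

theorem vec_zero (t : ℤ) : vec C t 0 = 0 := Finsupp.single_zero t

theorem vec_neg (t : ℤ) (a : ℂ) : vec C t (-a) = -vec C t a := Finsupp.single_neg t a

theorem mod_induction {p : Mod C → Prop} (x : Mod C) (h0 : p 0)
    (ha : ∀ x y, p x → p y → p (x + y)) (hs : ∀ t z, p (vec C t z)) : p x :=
  Finsupp.induction_linear x h0 ha hs

theorem add_act (x y : Alg) (v : Mod C) : ⁅x + y, v⁆ = ⁅x, v⁆ + ⁅y, v⁆ := by simp [act_def]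
theorem act_add (x : Alg) (v w : Mod C) : ⁅x, v + w⁆ = ⁅x, v⁆ + ⁅x, w⁆ := by simp [act_def]
theorem zero_act (v : Mod C) : ⁅(0 : Alg), v⁆ = 0 := by simp [act_def]
theorem act_zero (x : Alg) : ⁅x, (0 : Mod C)⁆ = 0 := by simp [act_def]
theorem smul_act (a : ℂ) (x : Alg) (v : Mod C) : ⁅a • x, v⁆ = a • ⁅x, v⁆ := by simp [act_def]
theorem act_smul (a : ℂ) (x : Alg) (v : Mod C) : ⁅x, a • v⁆ = a • ⁅x, v⁆ := by simp [act_def]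
theorem neg_act (x : Alg) (v : Mod C) : ⁅-x, v⁆ = -⁅x, v⁆ := by simp [act_def]

theorem leibniz_gen (x y : Gen) (t : ℤ) (a b c : ℂ) :
    ⁅mono x a, ⁅mono y b, vec C t c⁆⁆
      = ⁅⁅mono x a, mono y b⁆, vec C t c⁆ + ⁅mono y b, ⁅mono x a, vec C t c⁆⁆ := by
  rcases x with l | l | _ | _ | _ <;> rcases y with m | m | _ | _ | _ <;>
    simp only [lie_mono, act_mono, bracketGen, actGen, act_smul, smul_act, add_act, neg_act,
      act_zero, zero_act, smul_zero, smul_add, smul_neg, smul_mono, smul_vec, add_zero, zero_add,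
      neg_zero, mul_zero, zero_mul]
  · rw [show m + (l + t) = l + (m + t) by ring, show l + m + t = l + (m + t) by ring, ← vec_add]
    congr 1
    linear_combination a * b * c * C.LL l m t
  · rw [show m + (l + t) = l + (m + t) by ring, show l + m + t = l + (m + t) by ring, ← vec_add]
    congr 1
    linear_combination a * b * c * C.LI l m t
  · rw [show m + (l + t) = l + (m + t) by ring, show m + l + t = l + (m + t) by ring, ← vec_neg,
      ← vec_add]
    congr 1
    linear_combination -(a * b * c) * C.LI m l t
  · rw [show m + (l + t) = l + (m + t) by ring]
    congr 1
    linear_combination a * b * c * C.II l m t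

instance : LieRingModule Alg (Mod C) where
  add_lie := add_act C
  lie_add := act_add C
  leibniz_lie x y v := by
    induction x using alg_induction with
    | h0 => simp [zero_act, act_zero]
    | ha a b h1 h2 => simp only [add_act, act_add, add_lie, h1, h2]; abel
    | hs g u =>
      induction y using alg_induction with
      | h0 => simp [zero_act, act_zero]
      | ha a b h1 h2 => simp only [add_act, act_add, lie_add, h1, h2]; abel
      | hs g' u' =>
        induction v using mod_induction C with
        | h0 => simp [act_zero]
        | ha a b h1 h2 => simp only [act_add, h1, h2]; abel
        | hs t u'' => exact leibniz_gen C g g' t u u' u''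

instance : LieModule ℂ Alg (Mod C) where
  smul_lie a x v := by simp [act_def]
  lie_smul a x v := by simp [act_def]

end

theorem cast_cases (m n t : ℤ) :
    (n + t = 0 → (t : ℂ) = -n) ∧ (m + t = 0 → (t : ℂ) = -m) ∧
      (m + n + t = 0 → (t : ℂ) = -m - n) ∧ (t = 0 → (t : ℂ) = 0) := by
  refine ⟨fun h => ?_, fun h => ?_, fun h => ?_, fun h => ?_⟩
  · obtain rfl : t = -n := by lia
    simp
  · obtain rfl : t = -m := by lia
    simp
  · obtain rfl : t = -m - n := by lia
    simp
  · simp [h]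

/-- `A_{a,b,c}`: `L(n) v_t = (a+t+bn) v_{n+t}`, `I(n) v_t = c v_{n+t}`. -/
def coeffsA (a b c : ℂ) : Coeffs where
  ℓ n t := a + t + b * n
  f _ _ := c
  LL m n t := by push_cast; ring
  LI m n t := by push_cast; ring
  II m n t := rfl

/-- `A(a, d)`: `L(n) v_t = (t+n) v_{n+t}` and `I(n) v_t = 0` for `t ≠ 0`,
`L(n) v_0 = n(n+a) v_n`, `I(n) v_0 = d n v_n`. -/
def coeffsA' (a d : ℂ) : Coeffs where
  ℓ n t := if t = 0 then n * (n + a) else t + n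
  f n t := if t = 0 then d * n else 0
  LL m n t := by
    obtain ⟨h1, h2, h3, h4⟩ := cast_cases m n t
    push_cast
    by_cases e1 : n + t = 0 <;> by_cases e2 : m + t = 0 <;> by_cases e3 : m + n + t = 0 <;>
      by_cases e4 : t = 0 <;> simp only [e1, e2, e3, e4, if_true, if_false] at * <;>
      first | lia | grind
  LI m n t := by
    obtain ⟨h1, h2, h3, h4⟩ := cast_cases m n t
    push_cast
    grind
  II m n t := by
    obtain ⟨h1, h2, h3, h4⟩ := cast_cases m n t
    push_cast
    grind

/-- `B(a, d)`: `L(n) v_t = t v_{n+t}` and `I(n) v_t = 0` for `t ≠ -n`,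
`L(n) v_{-n} = -n(n+a) v_0`, `I(n) v_{-n} = d n v_0`. -/
def coeffsB (a d : ℂ) : Coeffs where
  ℓ n t := if n + t = 0 then -n * (n + a) else t
  f n t := if n + t = 0 then d * n else 0
  LL m n t := by
    obtain ⟨h1, h2, h3, h4⟩ := cast_cases m n t
    simp only [add_left_comm n m t, ← add_assoc m n t]
    push_cast
    by_cases e1 : n + t = 0 <;> by_cases e2 : m + t = 0 <;> by_cases e3 : m + n + t = 0 <;>
      by_cases e4 : t = 0 <;> simp only [e1, e2, e3, e4, if_true, if_false] at * <;>
      first | lia | grind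
  LI m n t := by
    obtain ⟨h1, h2, h3, h4⟩ := cast_cases m n t
    simp only [add_left_comm n m t, ← add_assoc m n t]
    push_cast
    by_cases e1 : n + t = 0 <;> by_cases e2 : m + t = 0 <;> by_cases e3 : m + n + t = 0 <;>
      by_cases e4 : t = 0 <;> simp only [e1, e2, e3, e4, if_true, if_false] at * <;>
      first | lia | grind
  II m n t := by
    obtain ⟨h1, h2, h3, h4⟩ := cast_cases m n t
    push_cast
    grind

/-- `U_d`: `L(n) v_t = t v_{n+t}`, `I(n) v_t = 0` for `n + t ≠ 0`, `I(n) v_{-n} = n d v_0`. -/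
def coeffsU (d : ℂ) : Coeffs where
  ℓ _ t := t
  f n t := if n + t = 0 then n * d else 0
  LL m n t := by
    obtain ⟨h1, h2, h3, h4⟩ := cast_cases m n t
    push_cast
    grind
  LI m n t := by
    obtain ⟨h1, h2, h3, h4⟩ := cast_cases m n t
    simp only [add_left_comm n m t, ← add_assoc m n t]
    push_cast
    by_cases e1 : n + t = 0 <;> by_cases e2 : m + t = 0 <;> by_cases e3 : m + n + t = 0 <;>
      by_cases e4 : t = 0 <;> simp only [e1, e2, e3, e4, if_true, if_false] at * <;>
      first | lia | grind
  II m n t := by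
    obtain ⟨h1, h2, h3, h4⟩ := cast_cases m n t
    push_cast
    grind

/-- `V_d`: `L(n) v_t = (t+n) v_{n+t}`, `I(n) v_t = 0` for `t ≠ 0`, `I(n) v_0 = n d v_n`. -/
def coeffsV (d : ℂ) : Coeffs where
  ℓ n t := t + n
  f n t := if t = 0 then n * d else 0
  LL m n t := by
    obtain ⟨h1, h2, h3, h4⟩ := cast_cases m n t
    push_cast
    grind
  LI m n t := by
    obtain ⟨h1, h2, h3, h4⟩ := cast_cases m n t
    push_cast
    grind
  II m n t := by
    obtain ⟨h1, h2, h3, h4⟩ := cast_cases m n t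
    push_cast
    grind

/-- `Ũ_d`: `L(n) v_t = t v_{n+t}` and `I(n) v_t = 0` for `n + t ≠ 0`,
`L(n) v_{-n} = 0`, `I(n) v_{-n} = d n v_0`. -/
def coeffsU' (d : ℂ) : Coeffs where
  ℓ n t := if n + t = 0 then 0 else t
  f n t := if n + t = 0 then d * n else 0
  LL m n t := by
    obtain ⟨h1, h2, h3, h4⟩ := cast_cases m n t
    push_cast
    grind
  LI m n t := by
    obtain ⟨h1, h2, h3, h4⟩ := cast_cases m n t
    simp only [add_left_comm n m t, ← add_assoc m n t]
    push_cast
    by_cases e1 : n + t = 0 <;> by_cases e2 : m + t = 0 <;> by_cases e3 : m + n + t = 0 <;>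
      by_cases e4 : t = 0 <;> simp only [e1, e2, e3, e4, if_true, if_false] at * <;>
      first | lia | grind
  II m n t := by
    obtain ⟨h1, h2, h3, h4⟩ := cast_cases m n t
    push_cast
    grind

/-- `Ṽ_c`: `L(n) v_t = t v_{n+t}` for `n + t ≠ 0`, `L(n) v_{-n} = 0`,
`I(n) v_0 = c v_n` for `n ≠ 0`, and `I(n) v_t = 0` if `t ≠ 0` or `n = t = 0`. -/
def coeffsV' (c : ℂ) : Coeffs where
  ℓ n t := if n + t = 0 then 0 else t
  f n t := if t = 0 ∧ n ≠ 0 then c else 0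
  LL m n t := by
    obtain ⟨h1, h2, h3, h4⟩ := cast_cases m n t
    push_cast
    grind
  LI m n t := by
    obtain ⟨h1, h2, h3, h4⟩ := cast_cases m n t
    push_cast
    grind
  II m n t := by
    obtain ⟨h1, h2, h3, h4⟩ := cast_cases m n t
    push_cast
    grind

/-- The parameters of the seven families of modules. -/
inductive Param : Type
  | A (a b c : ℂ)
  | A' (a d : ℂ)
  | B (a d : ℂ)
  | U (d : ℂ)
  | V (d : ℂ)
  | U' (d : ℂ) (hd : d ≠ 0)
  | V' (c : ℂ) (hc : c ≠ 0)

/-- The structure constants of the module with the given parameters. -/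
def Param.coeffs : Param → Coeffs
  | .A a b c => coeffsA a b c
  | .A' a d => coeffsA' a d
  | .B a d => coeffsB a d
  | .U d => coeffsU d
  | .V d => coeffsV d
  | .U' d _ => coeffsU' d
  | .V' c _ => coeffsV' c

/-- The listed module with parameters `p`. -/
abbrev Series (p : Param) : Type := Mod p.coeffs

universe u

variable (V : Type u) [AddCommGroup V] [Module ℂ V] [LieRingModule Alg V] [LieModule ℂ Alg V]

/-- The eigenspace `{v | L(0) v = μ v}`. -/
def weightSpace (μ : ℂ) : Submodule ℂ V :=
  Module.End.eigenspace (LieModule.toEnd ℂ Alg V (mono (.L 0) 1)) μ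

/-- A weight module: the direct sum of the eigenspaces of `L(0)` (eigenspaces for different
eigenvalues are automatically independent). -/
def IsWeightModule : Prop := ⨆ μ, weightSpace V μ = ⊤

/-- Nonzero, and not the direct sum of two nonzero submodules. -/
def IsIndecomposable : Prop :=
  Nontrivial V ∧ ∀ N P : LieSubmodule ℂ Alg V, IsCompl N P → N = ⊥ ∨ P = ⊥

/-- A Harish-Chandra module: an indecomposable weight module with finite-dimensional weight
spaces. -/
def IsHarishChandra : Prop :=
  IsIndecomposable V ∧ IsWeightModule V ∧ ∀ μ, FiniteDimensional ℂ (weightSpace V μ)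

/-- A Harish-Chandra module of the intermediate series: the action is nontrivial and all weight
spaces are at most one-dimensional. -/
def IsIntermediateSeries : Prop :=
  IsHarishChandra V ∧ ¬ LieModule.IsTrivial Alg V ∧ ∀ μ, Module.rank ℂ (weightSpace V μ) ≤ 1

/-- `V` is isomorphic to a nontrivial simple subquotient `N / P` of `M`. -/
def IsNontrivialSimpleSubquotient (M : Type) [AddCommGroup M] [Module ℂ M] [LieRingModule Alg M]
    [LieModule ℂ Alg M] : Prop :=
  ∃ (N : LieSubmodule ℂ Alg M) (P : LieSubmodule ℂ Alg N),
    LieModule.IsIrreducible ℂ Alg (N ⧸ P) ∧ ¬ LieModule.IsTrivial Alg (N ⧸ P) ∧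
      Nonempty (V ≃ₗ⁅ℂ,Alg⁆ (N ⧸ P))

end TwistedHV

end

/-!
A basis vector in each weight space turns `V` into a table of structure constants, determined up to
rescaling the basis vectors; the centre and `I(0)` act by scalars, since `V` is indecomposable with
weight multiplicities at most one.

If the support is not a point, it contains a ray, along which the rescaling-invariant products
`ℓ₋₁ ℓ₁`, `ℓ₋₁ ℓ₋₁ ℓ₂` and `ℓ₋₂ ℓ₁ ℓ₁` are polynomials in the weight. Computing
`ℓ₋₁ ℓ₁ · ℓ₋₁ ℓ₁ · ℓ₋₂ ℓ₂` in two ways forces the central charge to vanish and puts the coefficients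
of these polynomials on a nodal cubic, whose parameter is the `b` of a module of densities
`A_{a,b}`. So the ray looks like `A_{a,b}`, and this extends downwards one vector at a time, the
only obstruction being a vector of weight `0` when `b` is `0` or `1`. The brackets `[L(m), I(n)]`
then determine `I(n)` away from that vector, and cocycle identities determine all the matrix entries
at it; passing to the contragredient exchanges the entries into and out of it.
-/

noncomputable section

namespace TwistedHV

/-! ### Structure constants over the Virasoro algebra -/

section Coefficients

variable {A B E : ℤ → ℤ → ℂ} {X Y : Set ℤ} {s r : ℤ → ℂˣ}

/-- The coefficients of the action `v_t ↦ A n t • v_{n+t}` with respect to the basis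
`s t • v_t`. -/
def conj (s : ℤ → ℂˣ) (A : ℤ → ℤ → ℂ) (n t : ℤ) : ℂ :=
  ↑(s (n + t))⁻¹ * A n t * s t

/-- The coefficients of the action transposed along an anti-involution `x(n) ↦ x(-n)`; this is the
contragredient action on the restricted dual. -/
def transpose (A : ℤ → ℤ → ℂ) (n t : ℤ) : ℂ := A (-n) (n + t)

/-- Passing to the basis `s t • v_t` turns the coefficients `A` into `B`, as far as matrix entries
between degrees in `X` are concerned. -/
def IsGaugeOn (X : Set ℤ) (s : ℤ → ℂˣ) (A B : ℤ → ℤ → ℂ) : Prop :=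
  ∀ n t, t ∈ X → n + t ∈ X → A n t * s t = s (n + t) * B n t

/-- The coefficients of `L(n)` on the module `A_{a,b}` of densities. -/
def density (a b : ℂ) (n t : ℤ) : ℂ := a + t + b * n

theorem conj_eq_iff {n t : ℤ} {x : ℂ} : conj s A n t = x ↔ A n t * s t = s (n + t) * x := by
  rw [conj, mul_assoc, Units.inv_mul_eq_iff_eq_mul]

theorem conj_eq_zero_iff {n t : ℤ} : conj s A n t = 0 ↔ A n t = 0 := by
  rw [conj_eq_iff, mul_zero, Units.mul_left_eq_zero]

theorem conj_zero_left (t : ℤ) : conj s A 0 t = A 0 t := by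
  rw [conj_eq_iff, zero_add, mul_comm]

theorem conj_mul_conj (m n t : ℤ) : conj s A m (n + t) * conj s B n t
    = ↑(s (m + n + t))⁻¹ * (A m (n + t) * B n t) * s t := by
  rw [conj, conj, add_assoc m n t]
  linear_combination (↑(s (m + (n + t)))⁻¹ * A m (n + t) * B n t * s t : ℂ)
    * (s (n + t)).mul_inv

theorem transpose_transpose : transpose (transpose A) = A := by
  funext n t
  rw [transpose, transpose, neg_neg, neg_add_cancel_left]

theorem isGaugeOn_conj (X : Set ℤ) (s : ℤ → ℂˣ) (A : ℤ → ℤ → ℂ) : IsGaugeOn X s A (conj s A) :=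
  fun _ _ _ _ => conj_eq_iff.1 rfl

namespace IsGaugeOn

theorem refl (X : Set ℤ) (A : ℤ → ℤ → ℂ) : IsGaugeOn X 1 A A :=
  fun _ _ _ _ => mul_comm _ _

theorem mono (h : IsGaugeOn Y s A B) (hXY : X ⊆ Y) : IsGaugeOn X s A B :=
  fun n t ht hnt => h n t (hXY ht) (hXY hnt)

theorem symm (h : IsGaugeOn X s A B) : IsGaugeOn X s⁻¹ B A := by
  intro n t ht hnt
  rw [Pi.inv_apply, Pi.inv_apply, Units.mul_inv_eq_iff_eq_mul, mul_assoc,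
    Units.eq_inv_mul_iff_mul_eq, h n t ht hnt]

theorem trans (h : IsGaugeOn X s A B) (h' : IsGaugeOn X r B E) : IsGaugeOn X (s * r) A E := by
  intro n t ht hnt
  simp only [Pi.mul_apply, Units.val_mul]
  linear_combination (r t : ℂ) * h n t ht hnt + (s (n + t) : ℂ) * h' n t ht hnt

theorem transpose (h : IsGaugeOn X s A B) :
    IsGaugeOn X s⁻¹ (transpose A) (transpose B) := by
  intro n t ht hnt
  have hst := h (-n) (n + t) hnt (by rwa [neg_add_cancel_left])
  rw [neg_add_cancel_left] at hst
  rw [Pi.inv_apply, Pi.inv_apply, Units.mul_inv_eq_iff_eq_mul, mul_assoc,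
    ← Units.inv_mul_eq_iff_eq_mul, inv_inv, TwistedHV.transpose, TwistedHV.transpose]
  linear_combination hst

theorem of_transpose (h : IsGaugeOn X s (TwistedHV.transpose A) B) :
    IsGaugeOn X s⁻¹ A (TwistedHV.transpose B) := by
  simpa only [transpose_transpose] using h.transpose

end IsGaugeOn

end Coefficients

/-- Structure constants of a weight module over the Virasoro algebra with weights in `wt + ℤ`, all
of multiplicity at most one: `supp` is the support, `c` the central charge, and
`L(n) v_t = ℓ n t • v_{n+t}`, where `v_t` has weight `wt + t` and vanishes off `supp`. The weight
`0` is only allowed in degree `0`. -/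
structure VirSystem where
  supp : Set ℤ
  wt : ℂ
  c : ℂ
  ℓ : ℤ → ℤ → ℂ
  normalized : wt = 0 ∨ ∀ t : ℤ, wt + t ≠ 0
  source : ∀ n t, t ∉ supp → ℓ n t = 0
  target : ∀ n t, n + t ∉ supp → ℓ n t = 0
  zero : ∀ t ∈ supp, ℓ 0 t = wt + t
  comm : ∀ m n, ∀ t ∈ supp, ℓ m (n + t) * ℓ n t - ℓ n (m + t) * ℓ m t
    = ((n : ℂ) - m) * ℓ (m + n) t + if m + n = 0 then ((m : ℂ) ^ 3 - m) / 12 * c else 0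

namespace VirSystem

variable (D : VirSystem) {T : ℤ}

theorem comm_of_ne {m n t a b d : ℤ} (ht : t ∈ D.supp) (ha : n + t = a) (hb : m + t = b)
    (hd : m + n = d) (h0 : d ≠ 0) : D.ℓ m a * D.ℓ n t - D.ℓ n b * D.ℓ m t
      = ((n : ℂ) - m) * D.ℓ d t := by
  subst ha hb hd
  rw [D.comm m n t ht, if_neg h0, add_zero]

theorem comm_neg {n t a b : ℤ} (ht : t ∈ D.supp) (ha : n + t = a) (hb : -n + t = b) :
    D.ℓ (-n) a * D.ℓ n t - D.ℓ n b * D.ℓ (-n) t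
      = 2 * n * (D.wt + t) - ((n : ℂ) ^ 3 - n) / 12 * D.c := by
  subst ha hb
  rw [D.comm (-n) n t ht, neg_add_cancel, if_pos rfl, D.zero t ht]
  push_cast
  ring

/-- The system of the module twisted by the automorphism `L(n) ↦ -L(-n)`. -/
def flip : VirSystem where
  supp := {t | -t ∈ D.supp}
  wt := -D.wt
  c := -D.c
  ℓ n t := -D.ℓ (-n) (-t)
  normalized := D.normalized.imp (fun h => by rw [h, neg_zero]) fun h t e =>
    h (-t) (by push_cast; linear_combination -e)
  source _ _ ht := by rw [D.source _ _ ht, neg_zero]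
  target _ _ ht := by rw [D.target _ _ (by rwa [← neg_add]), neg_zero]
  zero t ht := by
    rw [neg_zero, D.zero _ ht]
    push_cast
    ring
  comm m n t ht := by
    have h := D.comm (-m) (-n) (-t) ht
    simp only [← neg_add, neg_eq_zero] at h ⊢
    push_cast at h
    split_ifs at h ⊢ <;> linear_combination h

/-- The system of the contragredient module, on which `L(n)` acts by the transpose of `L(-n)`. -/
def contragredient : VirSystem where
  supp := D.supp
  wt := D.wt
  c := D.c
  ℓ := transpose D.ℓ
  normalized := D.normalized
  source _ _ ht := D.target _ _ (by rwa [neg_add_cancel_left])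
  target _ _ ht := D.source _ _ ht
  zero t ht := by rw [transpose, neg_zero, zero_add, D.zero t ht]
  comm m n t ht := by
    have e : m + (n + t) = m + n + t := (add_assoc m n t).symm
    have e' : n + (m + t) = m + n + t := by ring
    simp only [transpose, e, e']
    by_cases hmn : m + n + t ∈ D.supp
    · have h := D.comm (-n) (-m) (m + n + t) hmn
      rw [show -m + (m + n + t) = n + t by ring, show -n + (m + n + t) = m + t by ring,
        show -n + -m = -(m + n) by ring] at h
      simp only [neg_eq_zero] at h
      rw [mul_comm (D.ℓ (-m) _), mul_comm (D.ℓ (-n) (m + n + t)), h]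
      split_ifs with h0
      · rw [eq_neg_of_add_eq_zero_right h0]
        push_cast
        ring
      · push_cast
        ring
    · have h0 : m + n ≠ 0 := fun h0 => hmn (by rwa [h0, zero_add])
      simp only [D.source _ _ hmn, if_neg h0, mul_zero, zero_mul, add_zero,
        sub_zero]

/-- The system with respect to the basis `s t • v_t`. -/
def rescale (s : ℤ → ℂˣ) : VirSystem where
  supp := D.supp
  wt := D.wt
  c := D.c
  ℓ := conj s D.ℓ
  normalized := D.normalized
  source n t ht := conj_eq_zero_iff.2 (D.source n t ht)
  target n t ht := conj_eq_zero_iff.2 (D.target n t ht)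
  zero t ht := by rw [conj_zero_left, D.zero t ht]
  comm m n t ht := by
    rw [conj_mul_conj, conj_mul_conj, add_comm n m, ← sub_mul, ← mul_sub, D.comm m n t ht, conj]
    split_ifs with h0
    · rw [h0, zero_add]
      linear_combination (((m : ℂ) ^ 3 - m) / 12 * D.c) * (s t).inv_mul
    · ring

end VirSystem

section Segments

variable {X : Set ℤ} {t : ℤ}

theorem exists_upper_end (ht : t ∈ X) (h : ¬ ∃ T, Set.Ici T ⊆ X) :
    ∃ q, t ≤ q ∧ q + 1 ∉ X ∧ Set.Icc t q ⊆ X := by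
  obtain ⟨r, htr, hr⟩ := Set.not_subset.1 (not_exists.1 h t)
  obtain ⟨q, ⟨htq, hq⟩, hmax⟩ := Int.exists_greatest_of_bdd
    (P := fun q => t ≤ q ∧ Set.Icc t q ⊆ X)
    ⟨r, fun q hq => le_of_not_gt fun hrq => hr (hq.2 ⟨htr, hrq.le⟩)⟩
    ⟨t, le_rfl, by simpa using ht⟩
  refine ⟨q, htq, fun hq1 => ?_, hq⟩
  have hle : q + 1 ≤ q := hmax _ ⟨by lia, fun x hx => by
    rcases eq_or_lt_of_le hx.2 with rfl | hlt
    · exact hq1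
    · exact hq ⟨hx.1, by lia⟩⟩
  lia

theorem exists_lower_end (ht : t ∈ X) (h : ¬ ∃ T, Set.Iic T ⊆ X) :
    ∃ p, p ≤ t ∧ p - 1 ∉ X ∧ Set.Icc p t ⊆ X := by
  obtain ⟨q, htq, hq, hsub⟩ := exists_upper_end (X := -X) (t := -t) (by simpa using ht) (by
    rintro ⟨T, hT⟩
    exact h ⟨-T, fun x hx => by simpa using hT (le_neg.1 hx : T ≤ -x)⟩)
  refine ⟨-q, by lia, by rwa [Set.mem_neg, neg_add'] at hq, fun x hx => ?_⟩
  simpa using hsub (⟨neg_le_neg hx.2, neg_le.1 hx.1⟩ : -x ∈ Set.Icc (-t) q)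

end Segments

namespace VirSystem

variable (D : VirSystem) {p q T : ℤ}

theorem lower_mul_raise_of_Icc (hp : p - 1 ∉ D.supp) (h : Set.Icc p q ⊆ D.supp) :
    ∀ t, p ≤ t → t ≤ q → D.ℓ (-1) (t + 1) * D.ℓ 1 t = (t - p + 1) * (2 * D.wt + t + p) := by
  intro t ht
  induction t, ht using Int.leInduction with
  | base =>
    intro hq
    have hcomm := D.comm_neg (n := 1) (a := p + 1) (b := p - 1) (h ⟨le_rfl, hq⟩) (by ring) (by ring)
    rw [D.source _ _ hp] at hcomm
    push_cast at hcomm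
    linear_combination hcomm
  | succ t ht ih =>
    intro hq
    have hcomm := D.comm_neg (n := 1) (a := t + 1 + 1) (b := t) (h ⟨by lia, hq⟩)
      (by ring) (by ring)
    have ih := ih (by lia)
    push_cast at hcomm ⊢
    linear_combination hcomm + ih

theorem wt_of_maximal_Icc (hpq : p ≤ q) (hp : p - 1 ∉ D.supp) (hq : q + 1 ∉ D.supp)
    (h : Set.Icc p q ⊆ D.supp) : 2 * D.wt + p + q = 0 := by
  have hprod := D.lower_mul_raise_of_Icc hp h q hpq le_rfl
  rw [D.source _ _ hq, zero_mul] at hprod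
  have hlen : (q : ℂ) - p + 1 ≠ 0 := by exact_mod_cast (by lia : q - p + 1 ≠ 0)
  linear_combination (mul_eq_zero.1 hprod.symm).resolve_left hlen

theorem supp_eq_Icc_of_no_ray (hr : ¬ ∃ T, Set.Ici T ⊆ D.supp) (hl : ¬ ∃ T, Set.Iic T ⊆ D.supp)
    (hne : D.supp.Nonempty) : ∃ p q, p ≤ q ∧ D.supp = Set.Icc p q := by
  have segment : ∀ t ∈ D.supp, ∃ p q : ℤ, p ≤ t ∧ t ≤ q ∧ p - 1 ∉ D.supp ∧ q + 1 ∉ D.supp ∧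
      Set.Icc p q ⊆ D.supp ∧ 2 * D.wt + p + q = 0 := by
    intro t ht
    obtain ⟨q, htq, hq, hsub⟩ := exists_upper_end ht hr
    obtain ⟨p, hpt, hp, hsub'⟩ := exists_lower_end ht hl
    have h : Set.Icc p q ⊆ D.supp := fun r hr => by
      rcases le_total r t with h | h
      · exact hsub' ⟨hr.1, h⟩
      · exact hsub ⟨h, hr.2⟩
    exact ⟨p, q, hpt, htq, hp, hq, h, D.wt_of_maximal_Icc (by lia) hp hq h⟩
  obtain ⟨t₀, ht₀⟩ := hne
  obtain ⟨p, q, hpt, htq, hp, -, hsub, hwt⟩ := segment t₀ ht₀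
  refine ⟨p, q, hpt.trans htq, hsub.antisymm' fun t ht => ?_⟩
  -- Maximal segments have the same centre, so they are nested, hence equal.
  obtain ⟨p', q', hpt', htq', hp', -, hsub', hwt'⟩ := segment t ht
  have hcentre : p + q = p' + q' := by
    have : (p : ℂ) + q = p' + q' := by linear_combination hwt - hwt'
    exact_mod_cast this
  have h₁ : ¬ p < p' := fun hlt => hp' (hsub ⟨by lia, by lia⟩)
  have h₂ : ¬ p' < p := fun hlt => hp (hsub' ⟨by lia, by lia⟩)
  exact ⟨by lia, by lia⟩

theorem of_supp_eq_Icc (hpq : p ≤ q) (hS : D.supp = Set.Icc p q) :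
    p = q ∧ D.wt + p = 0 ∧ D.c = 0 := by
  have hmem : ∀ t, p ≤ t → t ≤ q → t ∈ D.supp := fun t hp hq => by rw [hS]; exact ⟨hp, hq⟩
  have hnot : ∀ t, t < p ∨ q < t → t ∉ D.supp := fun t ht h => by
    rw [hS] at h
    exact ht.elim h.1.not_gt h.2.not_gt
  have hwt := D.wt_of_maximal_Icc hpq (hnot _ (by lia)) (hnot _ (by lia)) hS.ge
  have hcomm : ∀ n : ℤ, q - p < n → ∀ t, p ≤ t → t ≤ q →
      2 * n * (D.wt + t) - ((n : ℂ) ^ 3 - n) / 12 * D.c = 0 := fun n hn t hp hq => by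
    rw [← D.comm_neg (hmem t hp hq) rfl rfl, D.target n t (hnot _ (by lia)),
      D.target (-n) t (hnot _ (by lia))]
    ring
  have hp := hcomm (q - p + 1) (by lia) p le_rfl hpq
  have hq := hcomm (q - p + 1) (by lia) q hpq le_rfl
  have hlen : (q : ℂ) - p + 1 ≠ 0 := by exact_mod_cast (by lia : q - p + 1 ≠ 0)
  have hdiff : (q : ℂ) - p = 0 := by
    refine (mul_eq_zero.1 (?_ : ((q : ℂ) - p + 1) * (q - p) = 0)).resolve_left hlen
    push_cast at hp hq
    linear_combination (hq - hp) / 2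
  obtain rfl : p = q := by exact_mod_cast (sub_eq_zero.1 hdiff).symm
  have hwt0 : D.wt + p = 0 := by linear_combination hwt / 2
  refine ⟨rfl, hwt0, ?_⟩
  have h2 := hcomm 2 (by lia) p le_rfl le_rfl
  push_cast at h2
  linear_combination 8 * hwt0 - 2 * h2

theorem supp_eq_singleton_of_no_ray (hr : ¬ ∃ T, Set.Ici T ⊆ D.supp)
    (hl : ¬ ∃ T, Set.Iic T ⊆ D.supp) (hne : D.supp.Nonempty) :
    D.supp = {0} ∧ D.wt = 0 ∧ D.c = 0 := by
  obtain ⟨p, q, hpq, hS⟩ := D.supp_eq_Icc_of_no_ray hr hl hne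
  obtain ⟨rfl, hwt, hc⟩ := D.of_supp_eq_Icc hpq hS
  have hw : D.wt = 0 := D.normalized.resolve_right fun h => h p hwt
  rw [hw, zero_add, Int.cast_eq_zero] at hwt
  rw [hS, hwt, Set.Icc_self]
  exact ⟨rfl, hw, hc⟩

end VirSystem

section Polynomials

open Polynomial in
theorem eq_zero_of_infinite_roots {R : Type*} [CommRing R] [IsDomain R] {n : ℕ} {a : Fin n → R}
    (h : {z : R | ∑ i, a i * z ^ (i : ℕ) = 0}.Infinite) (i : Fin n) : a i = 0 := by
  have hp : ∑ j, C (a j) * X ^ (j : ℕ) = (0 : R[X]) :=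
    eq_zero_of_infinite_isRoot _ <| h.mono fun z hz => by
      simpa [IsRoot, eval_finsetSum] using hz
  simpa [finsetSum_coeff, coeff_C_mul, coeff_X_pow, Fin.val_inj] using congrArg (coeff · i) hp

theorem infinite_setOf_of_progression {P : ℂ → Prop} (a : ℂ) {d : ℂ} (hd : d ≠ 0)
    (h : ∀ j : ℕ, P (a + d * j)) : {z | P z}.Infinite :=
  Set.infinite_of_injective_forall_mem (f := fun j : ℕ => a + d * j)
    (fun _ _ hij => Nat.cast_injective (mul_left_cancel₀ hd (add_left_cancel hij))) h

theorem exists_eq_add_const {f g : ℤ → ℂ} {T : ℤ}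
    (h : ∀ t, T ≤ t → f (t + 1) - f t = g (t + 1) - g t) :
    ∃ k, ∀ t, T ≤ t → f t = g t + k := by
  refine ⟨f T - g T, fun t ht => ?_⟩
  induction t, ht using Int.leInduction with
  | base => ring
  | succ t ht ih => linear_combination h t ht + ih

theorem parameters_of_sextic_identity {γ β k k₁ k₂ : ℂ}
    (h : {z : ℂ | ((z - 1) * z + k) * (z * (z + 1) + k) * (z ^ 2 - γ * z + β)
      = (z ^ 3 + (3 * k - 1) * z + k₁) * (z ^ 3 + (3 * k - 1) * z + k₂)}.Infinite) :
    γ = 0 ∧ k₂ = -k₁ ∧ k₁ ^ 2 = k ^ 2 * (1 - 4 * k) := by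
  have hcoeff := eq_zero_of_infinite_roots (a := ![β * k ^ 2 - k₁ * k₂,
    -γ * k ^ 2 - (k₁ + k₂) * (3 * k - 1), k ^ 2 + β * (2 * k - 1) - (3 * k - 1) ^ 2,
    -γ * (2 * k - 1) - (k₁ + k₂), β + 1 - 4 * k, -γ]) <| h.mono fun z hz => by
      rw [Set.mem_ofPred_eq] at hz ⊢
      simp [Fin.sum_univ_six]
      linear_combination hz
  have hγ : γ = 0 := neg_eq_zero.1 (hcoeff 5)
  have hβ : β + 1 - 4 * k = 0 := hcoeff 4
  have h₃ : -γ * (2 * k - 1) - (k₁ + k₂) = 0 := hcoeff 3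
  have h₀ : β * k ^ 2 - k₁ * k₂ = 0 := hcoeff 0
  have hk₂ : k₂ = -k₁ := by linear_combination -h₃ - (2 * k - 1) * hγ
  exact ⟨hγ, hk₂, by linear_combination h₀ + k₁ * hk₂ - k ^ 2 * hβ⟩

theorem exists_nodal_cubic_parameter {k k₁ : ℂ} (h : k₁ ^ 2 = k ^ 2 * (1 - 4 * k)) :
    ∃ b, k = b * (1 - b) ∧ k₁ = b * (1 - b) * (1 - 2 * b) := by
  obtain ⟨d, hd⟩ := IsAlgClosed.exists_pow_nat_eq (1 - 4 * k) two_pos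
  have hk : k = (1 - d) / 2 * (1 - (1 - d) / 2) := by linear_combination hd / 4
  have hk₁ : k₁ ^ 2 = (k * d) ^ 2 := by rw [h, mul_pow, hd]
  rcases sq_eq_sq_iff_eq_or_eq_neg.1 hk₁ with h | h
  · exact ⟨(1 - d) / 2, hk, by linear_combination h + d * hk⟩
  · exact ⟨(1 + d) / 2, by linear_combination hk, by linear_combination h - d * hk⟩

theorem exists_ne_zero_from (a : ℂ) : ∃ T : ℤ, ∀ t : ℤ, T ≤ t → a + t ≠ 0 := by
  by_cases h : ∃ t : ℤ, a + t = 0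
  · obtain ⟨t₀, h₀⟩ := h
    refine ⟨t₀ + 1, fun t ht e => ?_⟩
    have : t = t₀ := by exact_mod_cast add_left_cancel (e.trans h₀.symm)
    lia
  · exact ⟨0, fun t _ ht => h ⟨t, ht⟩⟩

theorem exists_gauge_of_ne_zero {x y : ℤ → ℂ} {T : ℤ} (hx : ∀ t, T ≤ t → x t ≠ 0)
    (hy : ∀ t, T ≤ t → y t ≠ 0) : ∃ s : ℤ → ℂˣ, ∀ t, T ≤ t → x t * s t = s (t + 1) * y t := by
  let ratio (t : ℤ) : ℂˣ := if h : x t / y t ≠ 0 then Units.mk0 _ h else 1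
  refine ⟨fun t => ∏ i ∈ Finset.range (t - T).toNat, ratio (T + i), fun t ht => ?_⟩
  have hratio : (ratio t : ℂ) = x t / y t := by
    simp only [ratio, dif_pos (div_ne_zero (hx t ht) (hy t ht)), Units.val_mk0]
  beta_reduce
  rw [show (t + 1 - T).toNat = (t - T).toNat + 1 by lia, Finset.prod_range_succ,
    show T + ((t - T).toNat : ℤ) = t by lia, Units.val_mul, hratio, mul_assoc,
    div_mul_cancel₀ _ (hy t ht), mul_comm]

end Polynomials

namespace VirSystem

variable {D : VirSystem} {T : ℤ} {b k : ℂ}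

theorem contragredient_ℓ (n t : ℤ) : D.contragredient.ℓ n t = D.ℓ (-n) (n + t) := rfl

theorem ray_quadratic (hT : Set.Ici T ⊆ D.supp) : ∃ k : ℂ, ∀ t, T ≤ t →
    D.ℓ (-1) (t + 1) * D.ℓ 1 t = (D.wt + t) * (D.wt + t + 1) + k :=
  exists_eq_add_const fun t ht => by
    have hcomm := D.comm_neg (n := 1) (a := t + 1 + 1) (b := t) (hT (by lia : T ≤ t + 1))
      (by ring) (by ring)
    push_cast at hcomm ⊢
    linear_combination hcomm

theorem ray_cubic (hT : Set.Ici T ⊆ D.supp)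
    (hk : ∀ t, T ≤ t → D.ℓ (-1) (t + 1) * D.ℓ 1 t = (D.wt + t) * (D.wt + t + 1) + k) :
    ∃ k₁ : ℂ, ∀ t, T ≤ t → D.ℓ (-1) (t + 1) * D.ℓ (-1) (t + 2) * D.ℓ 2 t
      = (D.wt + t + 1) ^ 3 + (3 * k - 1) * (D.wt + t + 1) + k₁ :=
  exists_eq_add_const fun t ht => by
    have hcomm := D.comm_of_ne (m := -1) (n := 2) (a := t + 3) (b := t) (d := 1)
      (hT (by lia : T ≤ t + 1)) (by ring) (by ring) (by ring) one_ne_zero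
    have hk := hk (t + 1) (by lia)
    rw [add_assoc t 1 1, one_add_one_eq_two] at hk ⊢
    rw [add_assoc t 1 2, show (1 + 2 : ℤ) = 3 by norm_num]
    push_cast at hcomm hk ⊢
    linear_combination D.ℓ (-1) (t + 2) * hcomm + 3 * hk

theorem ray_cubic_transpose (hT : Set.Ici T ⊆ D.supp)
    (hk : ∀ t, T ≤ t → D.ℓ (-1) (t + 1) * D.ℓ 1 t = (D.wt + t) * (D.wt + t + 1) + k) :
    ∃ k₂ : ℂ, ∀ t, T ≤ t → D.ℓ (-2) (t + 2) * D.ℓ 1 (t + 1) * D.ℓ 1 t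
      = (D.wt + t + 1) ^ 3 + (3 * k - 1) * (D.wt + t + 1) + k₂ := by
  obtain ⟨k₂, h⟩ := ray_cubic (D := D.contragredient) hT fun t ht => by
    rw [contragredient_ℓ, contragredient_ℓ, neg_neg, neg_add_cancel_comm_assoc, mul_comm,
      add_comm 1 t]
    exact hk t ht
  refine ⟨k₂, fun t ht => ?_⟩
  rw [← show D.contragredient.wt = D.wt from rfl, ← h t ht]
  simp only [contragredient_ℓ, neg_neg, neg_add_cancel_comm_assoc,
    show -1 + (t + 2) = t + 1 by ring, add_comm 2 t]
  ring

theorem ray_step_two (hT : Set.Ici T ⊆ D.supp) : ∃ β : ℂ, ∀ j : ℕ,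
    D.ℓ (-2) (T + 2 * j + 2) * D.ℓ 2 (T + 2 * j) = (D.wt + (T + 2 * j) + 1) ^ 2
      - D.c / 4 * (D.wt + (T + 2 * j) + 1) + β := by
  obtain ⟨β, hβ⟩ := exists_eq_add_const (T := 0)
    (f := fun j => D.ℓ (-2) (T + 2 * j + 2) * D.ℓ 2 (T + 2 * j))
    (g := fun j => (D.wt + (T + 2 * j) + 1) ^ 2 - D.c / 4 * (D.wt + (T + 2 * j) + 1))
    fun j hj => by
      have hcomm := D.comm_neg (n := 2) (a := T + 2 * (j + 1) + 2) (b := T + 2 * j)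
        (hT (by lia : T ≤ T + 2 * (j + 1))) (by ring) (by ring)
      rw [show T + 2 * (j + 1) = T + 2 * j + 2 by ring] at hcomm ⊢
      push_cast at hcomm ⊢
      linear_combination hcomm
  exact ⟨β, fun j => by simpa using hβ j (by lia)⟩

variable (D) in
/-- From degree `T` on, the basis-independent products of the coefficients of `L(±1)` and `L(±2)`
are those of the module of densities `A_{wt,b}`. -/
def HasDensityInvariants (b : ℂ) (T : ℤ) : Prop := ∀ t, T ≤ t →
  D.ℓ (-1) (t + 1) * D.ℓ 1 t = (D.wt + t + b) * (D.wt + t + 1 - b) ∧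
  D.ℓ (-1) (t + 1) * D.ℓ (-1) (t + 2) * D.ℓ 2 t
    = (D.wt + t + 2 * b) * (D.wt + t + 2 - b) * (D.wt + t + 1 - b) ∧
  D.ℓ (-2) (t + 2) * D.ℓ 1 (t + 1) * D.ℓ 1 t
    = (D.wt + t + b) * (D.wt + t + 1 + b) * (D.wt + t + 2 - 2 * b)

theorem HasDensityInvariants.contragredient (h : D.HasDensityInvariants b T) :
    D.contragredient.HasDensityInvariants (1 - b) T := by
  intro t ht
  obtain ⟨h₁, h₂, h₃⟩ := h t ht
  simp only [contragredient_ℓ, neg_neg, neg_add_cancel_comm_assoc,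
    show -1 + (t + 2) = t + 1 by ring, add_comm 1 t, add_comm 2 t,
    show D.contragredient.wt = D.wt from rfl, add_comm 1 (t + 1), add_assoc t 1 1,
    one_add_one_eq_two]
  exact ⟨by linear_combination h₁, by linear_combination h₃, by linear_combination h₂⟩

theorem HasDensityInvariants.rescale (h : D.HasDensityInvariants b T) (s : ℤ → ℂˣ) :
    (D.rescale s).HasDensityInvariants b T := by
  intro t ht
  obtain ⟨h₁, h₂, h₃⟩ := h t ht
  have e₁ : -1 + (t + 2) = t + 1 := by ring
  have e₂ : 1 + (t + 1) = t + 2 := by ring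
  simp only [VirSystem.rescale, conj, neg_add_cancel_comm_assoc, e₁, e₂, add_comm 1 t, add_comm 2 t,
    Units.val_inv_eq_inv_val, ← h₁, ← h₂, ← h₃]
  exact ⟨by field_simp, by field_simp, by field_simp⟩

theorem ray_invariants (hT : Set.Ici T ⊆ D.supp) :
    D.c = 0 ∧ ∃ b : ℂ, D.HasDensityInvariants b T := by
  obtain ⟨k, hk⟩ := ray_quadratic hT
  obtain ⟨k₁, h₁⟩ := ray_cubic hT hk
  obtain ⟨k₂, h₂⟩ := ray_cubic_transpose hT hk
  obtain ⟨β, hβ⟩ := ray_step_two hT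
  -- Compute `ℓ₋₁ ℓ₁ · ℓ₋₁ ℓ₁ · ℓ₋₂ ℓ₂` in two ways at the degrees `T + 2 * j`.
  obtain ⟨hγ, rfl, hk₁⟩ := parameters_of_sextic_identity (γ := D.c / 4) (β := β) (k := k)
    (k₁ := k₁) (k₂ := k₂) <| infinite_setOf_of_progression (D.wt + T + 1) two_ne_zero fun j => by
      have hj : T ≤ T + 2 * (j : ℤ) := by lia
      have hk' := hk (T + 2 * j + 1) (by lia)
      have h₁ := h₁ _ hj
      have h₂ := h₂ _ hj
      have hk := hk _ hj
      have hβ := hβ j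
      rw [add_assoc _ (1 : ℤ) 1, one_add_one_eq_two] at hk'
      push_cast at hk hk' h₁ h₂
      convert congrArg₂ (· * ·) h₁ h₂ using 1
      · rw [show ∀ x y z u v w : ℂ, x * y * z * (u * v * w) = x * w * (y * v) * (u * z) by
          intros; ring, hk, hk', hβ]
        ring
      · ring
  obtain ⟨b, rfl, rfl⟩ := exists_nodal_cubic_parameter hk₁
  refine ⟨by linear_combination 4 * hγ, b, fun t ht => ⟨?_, ?_, ?_⟩⟩
  · linear_combination hk t ht
  · linear_combination h₁ t ht
  · linear_combination h₂ t ht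

theorem eq_density_of_raising (hT : Set.Ici T ⊆ D.supp)
    (h1 : ∀ t, T ≤ t → D.ℓ 1 t = density D.wt b 1 t)
    (h2 : ∀ t, T ≤ t → D.ℓ 2 t = density D.wt b 2 t) {n : ℤ} (hn : 0 ≤ n) :
    ∀ t, T ≤ t → D.ℓ n t = density D.wt b n t := by
  obtain rfl | rfl | hn : n = 0 ∨ n = 1 ∨ 2 ≤ n := by lia
  · intro t ht
    rw [D.zero t (hT ht), density, Int.cast_zero, mul_zero, add_zero]
  · exact h1
  induction n, hn using Int.leInduction with
  | base => exact h2
  | succ n hn ih =>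
    intro t ht
    have hcomm := D.comm_of_ne (m := 1) (n := n) (d := n + 1) (hT ht) rfl rfl (by ring) (by lia)
    rw [h1 _ (by lia), h1 t ht, ih (by lia) t ht, ih (by lia) _ (by lia)] at hcomm
    have hn1 : (n : ℂ) - 1 ≠ 0 := sub_ne_zero.2 (by exact_mod_cast (by lia : n ≠ 1))
    apply mul_left_cancel₀ hn1
    simp only [density] at hcomm ⊢
    push_cast at hcomm ⊢
    linear_combination -hcomm

theorem eq_density_of_generators (hT : Set.Ici T ⊆ D.supp)
    (h1 : ∀ t, T ≤ t → D.ℓ 1 t = density D.wt b 1 t)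
    (h2 : ∀ t, T ≤ t → D.ℓ 2 t = density D.wt b 2 t)
    (h1' : ∀ t, T ≤ t → D.contragredient.ℓ 1 t = density D.wt (1 - b) 1 t)
    (h2' : ∀ t, T ≤ t → D.contragredient.ℓ 2 t = density D.wt (1 - b) 2 t) {n t : ℤ}
    (ht : T ≤ t) (hnt : T ≤ n + t) : D.ℓ n t = density D.wt b n t := by
  rcases le_total 0 n with hn | hn
  · exact eq_density_of_raising hT h1 h2 hn t ht
  · have h := eq_density_of_raising (D := D.contragredient) hT h1' h2' (neg_nonneg.2 hn) _ hnt
    rw [contragredient_ℓ, neg_neg, neg_add_cancel_left] at h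
    rw [h, density, density, contragredient]
    push_cast
    ring

theorem HasDensityInvariants.raise_two (h : D.HasDensityInvariants b T)
    (h1 : ∀ t, T ≤ t → D.ℓ (-1) (t + 1) = D.wt + t + 1 - b)
    (hne : ∀ t : ℤ, T ≤ t → D.wt + 1 - b + t ≠ 0) :
    ∀ t, T ≤ t → D.ℓ 2 t = density D.wt b 2 t := by
  intro t ht
  have h1' := h1 (t + 1) (by lia)
  have hne' := hne (t + 1) (by lia)
  have hcubic := (h t ht).2.1
  rw [add_assoc t 1 1, one_add_one_eq_two] at h1'
  rw [h1 t ht, h1'] at hcubic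
  apply mul_left_cancel₀ (mul_ne_zero (hne t ht) hne')
  simp only [density]
  push_cast at hcubic ⊢
  linear_combination hcubic

theorem HasDensityInvariants.eq_density (hT : Set.Ici T ⊆ D.supp) (h : D.HasDensityInvariants b T)
    (h1 : ∀ t, T ≤ t → D.ℓ 1 t = density D.wt b 1 t)
    (hne : ∀ t : ℤ, T ≤ t → D.wt + b + t ≠ 0) (hne' : ∀ t : ℤ, T ≤ t → D.wt + 1 - b + t ≠ 0)
    {n t : ℤ} (ht : T ≤ t) (hnt : T ≤ n + t) : D.ℓ n t = density D.wt b n t := by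
  have h1' : ∀ t, T ≤ t → D.ℓ (-1) (t + 1) = D.wt + t + 1 - b := fun t ht => by
    apply mul_right_cancel₀ (hne t ht)
    have hquad := (h t ht).1
    rw [h1 t ht, density, Int.cast_one] at hquad
    linear_combination hquad
  refine eq_density_of_generators hT h1 (h.raise_two h1' hne') (fun t ht => ?_)
    (h.contragredient.raise_two (fun t ht => ?_) fun t ht => ?_) ht hnt
  · rw [contragredient_ℓ, add_comm, h1' t ht, density, Int.cast_one]
    ring
  · rw [contragredient_ℓ, neg_neg, neg_add_cancel_comm_assoc, h1 t ht, density, Int.cast_one]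
    change _ = D.wt + t + 1 - (1 - b)
    ring
  · rw [show D.contragredient.wt + 1 - (1 - b) = D.wt + b by rw [VirSystem.contragredient]; ring]
    exact hne t ht

/-- Up the ray `L(1)` does not vanish, so it can be normalized to its value in a module of
densities; the invariants then determine `L(-1)` and `L(±2)`, and these generate. -/
theorem exists_isGaugeOn_density (hT : Set.Ici T ⊆ D.supp) : D.c = 0 ∧ ∃ b s T', 1 ≤ T' ∧
    Set.Ici T' ⊆ D.supp ∧ IsGaugeOn (Set.Ici T') s D.ℓ (density D.wt b) := by
  obtain ⟨hc, b, hb⟩ := ray_invariants hT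
  refine ⟨hc, b, ?_⟩
  obtain ⟨T₁, hT₁⟩ := exists_ne_zero_from (D.wt + b)
  obtain ⟨T₂, hT₂⟩ := exists_ne_zero_from (D.wt + 1 - b)
  obtain ⟨T', hTT', hT₁', hT₂', h1T'⟩ : ∃ T', T ≤ T' ∧ T₁ ≤ T' ∧ T₂ ≤ T' ∧ 1 ≤ T' :=
    ⟨max (max T T₁) (max T₂ 1), by simp⟩
  have hb' : D.HasDensityInvariants b T' := fun t ht => hb t (hTT'.trans ht)
  have hne : ∀ t : ℤ, T' ≤ t → D.wt + b + t ≠ 0 := fun t ht => hT₁ t (by lia)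
  have hne' : ∀ t : ℤ, T' ≤ t → D.wt + 1 - b + t ≠ 0 := fun t ht => hT₂ t (by lia)
  have hℓ : ∀ t, T' ≤ t → D.ℓ 1 t ≠ 0 := fun t ht h => by
    have hquad := (hb' t ht).1
    rw [h, mul_zero] at hquad
    exact mul_ne_zero (hne t ht) (hne' t ht) (by linear_combination -hquad)
  obtain ⟨s, hs⟩ := exists_gauge_of_ne_zero hℓ (y := density D.wt b 1) fun t ht h =>
    hne t ht (by simpa [density, add_right_comm] using h)
  have hT' : Set.Ici T' ⊆ D.supp := (Set.Ici_subset_Ici.2 hTT').trans hT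
  refine ⟨s, T', h1T', hT', fun n t ht hnt => conj_eq_iff.1 ?_⟩
  exact HasDensityInvariants.eq_density (D := D.rescale s) hT' (hb'.rescale s)
    (fun t ht => conj_eq_iff.2 (by rw [add_comm, hs t ht]; rfl)) hne hne' ht hnt

end VirSystem

section Gluing

theorem IsGaugeOn.insert {X : Set ℤ} {s : ℤ → ℂˣ} {A B : ℤ → ℤ → ℂ} {T : ℤ} {κ : ℂˣ}
    (h : IsGaugeOn X s A B) (hT : T ∉ X) (h0 : A 0 T = B 0 T)
    (hsource : ∀ u ∈ X, A (u - T) T * κ = s u * B (u - T) T)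
    (htarget : ∀ t ∈ X, A (T - t) t * s t = κ * B (T - t) t) :
    IsGaugeOn (insert T X) (Function.update s T κ) A B := by
  have hne : ∀ t ∈ X, t ≠ T := fun t ht e => hT (e ▸ ht)
  rintro n t (rfl | ht) (hnt | hnt)
  · obtain rfl : n = 0 := by lia
    rw [zero_add, h0, mul_comm]
  · have hu := hsource _ hnt
    rw [add_sub_cancel_right] at hu
    rwa [Function.update_self, Function.update_of_ne (hne _ hnt)]
  · have ht' := htarget t ht
    rw [← hnt, add_sub_cancel_right] at ht'
    rwa [hnt, Function.update_self, Function.update_of_ne (hne _ ht)]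
  · rw [Function.update_of_ne (hne _ ht), Function.update_of_ne (hne _ hnt)]
    exact h n t ht hnt

theorem exists_glued {α : Type*} {P : (ℤ → α) → ℤ → Prop}
    (step : ∀ s T, P s (T + 1) → ∃ κ, P (Function.update s T κ) T) {s : ℤ → α} {T : ℤ}
    (h : P s T) : ∃ s', ∀ T' ≤ T, ∃ r, P r T' ∧ Set.EqOn r s' (Set.Ici T') := by
  have step' : ∀ (j : ℕ) (x : {s // P s (T - j)}), ∃ y : {s // P s (T - (j + 1 : ℕ))},
      Set.EqOn y.1 x.1 (Set.Ici (T - j)) := by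
    rintro j ⟨s, hs⟩
    obtain ⟨κ, hκ⟩ := step s (T - (j + 1 : ℕ)) (by convert hs using 1; push_cast; ring)
    refine ⟨⟨_, hκ⟩, fun t (ht : T - j ≤ t) => Function.update_of_ne (by lia) _ _⟩
  choose next hnext using step'
  let x : ∀ j : ℕ, {s // P s (T - j)} := fun j => Nat.rec ⟨s, by simpa using h⟩ next j
  have stable : ∀ i j : ℕ, i ≤ j → Set.EqOn (x j).1 (x i).1 (Set.Ici (T - i)) := by
    intro i j hij
    induction j, hij using Nat.le_induction with
    | base => exact Set.eqOn_refl _ _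
    | succ j hij ih =>
      exact ((hnext j (x j)).mono (Set.Ici_subset_Ici.2 (by lia))).trans ih
  refine ⟨fun t => (x (T - t).toNat).1 t, fun T' hT' => ⟨(x (T - T').toNat).1, ?_, ?_⟩⟩
  · convert (x (T - T').toNat).2 using 1
    lia
  · intro t (ht : T' ≤ t)
    exact stable _ _ (by lia) (Set.mem_Ici.2 (by lia))

theorem exists_add_mul_ne_zero {x y : ℂ} (h : ¬ (x = 0 ∧ y = 0)) :
    ∃ m : ℤ, 1 ≤ m ∧ x + y * m ≠ 0 := by
  by_contra! hcon
  have h1 := hcon 1 le_rfl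
  have h2 := hcon 2 (by norm_num)
  push_cast at h1 h2
  exact h ⟨by linear_combination 2 * h1 - h2, by linear_combination h2 - h1⟩

end Gluing

namespace VirSystem

variable {D : VirSystem} {b : ℂ} {s : ℤ → ℂˣ} {T : ℤ}

theorem lower_mul_raise_of_isGaugeOn (hc : D.c = 0) (hS : Set.Ici (T + 1) ⊆ D.supp)
    (h : IsGaugeOn (Set.Ici (T + 1)) s D.ℓ (density D.wt b)) {t u : ℤ} (ht : T + 1 ≤ t)
    (hu : T + 1 ≤ u) : D.ℓ (u - T) T * (D.ℓ (T - t) t * s t)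
      = s u * (density D.wt b (u - T) T * density D.wt b (T - t) t) := by
  have hcomm := D.comm (u - T) (T - t) t (hS ht)
  rw [hc, mul_zero, ite_self, add_zero] at hcomm
  have h1 := h (u - T) t ht (Set.mem_Ici.2 (by lia))
  have h2 := h (T - t) (u - T + t) (Set.mem_Ici.2 (by lia)) (Set.mem_Ici.2 (by lia))
  have h3 := h (u - T + (T - t)) t ht (Set.mem_Ici.2 (by lia))
  rw [show T - t + (u - T + t) = u by ring] at h2
  rw [show u - T + (T - t) + t = u by ring] at h3
  rw [sub_add_cancel] at hcomm
  simp only [density] at h1 h2 h3 ⊢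
  push_cast at hcomm h1 h2 h3 ⊢
  linear_combination s t * hcomm + D.ℓ (T - t) (u - T + t) * h1 + (T - t - (u - T)) * h3
    + (D.wt + t + b * (u - T)) * h2

/-- One more vector is pinned down by its products with those above it, provided that these do not
all vanish. -/
theorem exists_isGaugeOn_update (hc : D.c = 0) (hS : Set.Ici (T + 1) ⊆ D.supp)
    (h : IsGaugeOn (Set.Ici (T + 1)) s D.ℓ (density D.wt b))
    (hne : ¬ (D.wt + T = 0 ∧ (b = 0 ∨ b = 1))) :
    ∃ κ, Set.Ici T ⊆ D.supp ∧
      IsGaugeOn (Set.Ici T) (Function.update s T κ) D.ℓ (density D.wt b) := by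
  have key := @lower_mul_raise_of_isGaugeOn D b s T hc hS h
  obtain ⟨m, hm, hm'⟩ := exists_add_mul_ne_zero fun h => hne ⟨h.1, Or.inl h.2⟩
  obtain ⟨n, hn, hn'⟩ := exists_add_mul_ne_zero (x := D.wt + T) (y := 1 - b) fun h =>
    hne ⟨h.1, Or.inr (sub_eq_zero.1 h.2).symm⟩
  have hraise : density D.wt b (T + m - T) T ≠ 0 := by rwa [add_sub_cancel_left]
  have hlower : density D.wt b (T - (T + n)) (T + n) ≠ 0 := fun h0 => hn' <| by
    rw [← h0, density]
    push_cast
    ring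
  have hmn : D.ℓ (T + m - T) T * (D.ℓ (T - (T + n)) (T + n) * s (T + n)) ≠ 0 := by
    rw [key (by lia : T + 1 ≤ T + n) (by lia : T + 1 ≤ T + m)]
    exact mul_ne_zero (s _).ne_zero (mul_ne_zero hraise hlower)
  have hℓ := left_ne_zero_of_mul hmn
  have hTS : T ∈ D.supp := by_contra fun hT => hℓ (D.source _ _ hT)
  let κ := s (T + m) * (Units.mk0 _ hraise / Units.mk0 _ hℓ)
  have hκ : (κ : ℂ) * D.ℓ (T + m - T) T = s (T + m) * density D.wt b (T + m - T) T := by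
    simp only [κ, Units.val_mul, Units.val_div_eq_div_val, Units.val_mk0]
    field_simp
  have hIci : Set.Ici T = insert T (Set.Ici (T + 1)) := by
    ext t
    simp only [Set.mem_Ici, Set.mem_insert_iff]
    lia
  rw [hIci]
  refine ⟨κ, Set.insert_subset hTS hS, h.insert (by simp) ?_ (fun u hu => ?_) fun t ht => ?_⟩
  · rw [D.zero _ hTS, density, Int.cast_zero, mul_zero, add_zero]
  · apply mul_right_cancel₀ hmn
    linear_combination (D.ℓ (u - T) T * (D.ℓ (T - (T + n)) (T + n) * s (T + n))) * hκ
      + s (T + m) * density D.wt b (T + m - T) T * key (by lia : T + 1 ≤ T + n) hu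
      - s u * density D.wt b (u - T) T * key (by lia : T + 1 ≤ T + n) (by lia : T + 1 ≤ T + m)
  · apply mul_left_cancel₀ hℓ
    linear_combination key ht (by lia : T + 1 ≤ T + m) - density D.wt b (T - t) t * hκ

end VirSystem

/-- The gauge `v_t ↦ t • v_t`, which relates densities of weight `0` and `1` away from degree
`0`. -/
def degreeUnit (t : ℤ) : ℂˣ :=
  if h : t = 0 then 1 else Units.mk0 (t : ℂ) (Int.cast_ne_zero.2 h)

theorem coe_degreeUnit {t : ℤ} (ht : t ≠ 0) : (degreeUnit t : ℂ) = t := by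
  rw [degreeUnit, dif_neg ht, Units.val_mk0]

theorem isGaugeOn_degreeUnit :
    IsGaugeOn {0}ᶜ degreeUnit (density 0 1) (density 0 0) := by
  intro n t ht hnt
  rw [coe_degreeUnit ht, coe_degreeUnit hnt]
  simp only [density]
  push_cast
  ring

namespace VirSystem

variable {D : VirSystem} {b : ℂ} {s s' : ℤ → ℂˣ} {T : ℤ}

theorem exists_isGaugeOn_univ (hc : D.c = 0) (hb : ¬ (D.wt = 0 ∧ (b = 0 ∨ b = 1)))
    (hS : Set.Ici T ⊆ D.supp) (h : IsGaugeOn (Set.Ici T) s D.ℓ (density D.wt b)) :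
    D.supp = Set.univ ∧ ∃ s, IsGaugeOn Set.univ s D.ℓ (density D.wt b) := by
  obtain ⟨s', hs'⟩ := exists_glued
    (P := fun s T => Set.Ici T ⊆ D.supp ∧ IsGaugeOn (Set.Ici T) s D.ℓ (density D.wt b))
    (fun s T h => exists_isGaugeOn_update hc h.1 h.2 fun hT =>
      hb ⟨D.normalized.resolve_right fun h => h T hT.1, hT.2⟩) ⟨hS, h⟩
  refine ⟨Set.eq_univ_of_forall fun t => ?_, s', fun n t _ _ => ?_⟩
  · obtain ⟨r, hr, -⟩ := hs' (min T t) (min_le_left _ _)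
    exact hr.1 (Set.mem_Ici.2 (min_le_right _ _))
  · obtain ⟨r, hr, hrs⟩ := hs' (min T (min t (n + t))) (min_le_left _ _)
    have ht : t ∈ Set.Ici (min T (min t (n + t))) := by simp
    have hnt : n + t ∈ Set.Ici (min T (min t (n + t))) := by simp
    rw [← hrs ht, ← hrs hnt]
    exact hr.2 n t ht hnt

theorem exists_isGaugeOn_Ici_one (hc : D.c = 0) (hw : D.wt = 0) (hT : 1 ≤ T)
    (hS : Set.Ici T ⊆ D.supp) (h : IsGaugeOn (Set.Ici T) s D.ℓ (density D.wt b)) :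
    Set.Ici 1 ⊆ D.supp ∧ ∃ s, IsGaugeOn (Set.Ici 1) s D.ℓ (density D.wt b) := by
  induction T, hT using Int.leInduction generalizing s with
  | base => exact ⟨hS, s, h⟩
  | succ T hT ih =>
    obtain ⟨κ, hS', h'⟩ := exists_isGaugeOn_update hc hS h fun h0 => by
      rw [hw, zero_add, Int.cast_eq_zero] at h0
      lia
    exact ih hS' h'

variable (D)

/-- The module is a module of densities `A_{wt,b}` which is not one of the reducible modules
`A_{0,0}` and `A_{0,1}`. -/
def IsGlobal : Prop :=
  D.supp = Set.univ ∧ ∃ b s, ¬ (D.wt = 0 ∧ (b = 0 ∨ b = 1)) ∧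
    IsGaugeOn Set.univ s D.ℓ (density D.wt b)

/-- Away from degree `0` the module looks like `A_{0,0}`. -/
def IsPunctured : Prop :=
  D.wt = 0 ∧ {0}ᶜ ⊆ D.supp ∧ ∃ s, IsGaugeOn {0}ᶜ s D.ℓ (density 0 0)

variable {D}

theorem isGaugeOn_neg_of_flip {X : Set ℤ} {a : ℂ} (h : IsGaugeOn X s D.flip.ℓ (density (-a) b)) :
    IsGaugeOn (-X) (fun t => s (-t)) D.ℓ (density a b) := by
  intro n t ht hnt
  have hst := h (-n) (-t) ht (by rwa [← neg_add])
  simp only [flip, density, neg_neg, ← neg_add] at hst ⊢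
  push_cast at hst
  linear_combination -hst

theorem IsGlobal.of_flip (h : D.flip.IsGlobal) : D.IsGlobal := by
  obtain ⟨hS, b, s, hb, h⟩ := h
  refine ⟨Set.eq_univ_of_forall fun t => ?_, b, fun t => s (-t), ?_, ?_⟩
  · have ht : -t ∈ D.flip.supp := hS ▸ Set.mem_univ _
    simpa only [flip, Set.mem_ofPred_eq, neg_neg] using ht
  · simpa only [flip, neg_eq_zero] using hb
  · simpa only [Set.neg_univ] using isGaugeOn_neg_of_flip h

theorem IsPunctured.of_flip (h : D.flip.IsPunctured) : D.IsPunctured := by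
  obtain ⟨hw, hS, s, h⟩ := h
  refine ⟨neg_eq_zero.1 hw, fun t ht => ?_, fun t => s (-t), ?_⟩
  · have ht' : -t ∈ D.flip.supp := hS (neg_ne_zero.2 ht)
    simpa only [flip, Set.mem_ofPred_eq, neg_neg] using ht'
  · exact (isGaugeOn_neg_of_flip (a := 0) (by rwa [neg_zero])).mono fun t ht => neg_ne_zero.2 ht

theorem ray_dichotomy (hT : Set.Ici T ⊆ D.supp) :
    D.c = 0 ∧ (D.IsGlobal ∨ D.wt = 0 ∧ Set.Ici 1 ⊆ D.supp ∧
      ∃ s, IsGaugeOn (Set.Ici 1) s D.ℓ (density 0 0)) := by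
  obtain ⟨hc, b, s, T', hT', hS, h⟩ := exists_isGaugeOn_density hT
  refine ⟨hc, ?_⟩
  by_cases hb : D.wt = 0 ∧ (b = 0 ∨ b = 1)
  · obtain ⟨hw, hb⟩ := hb
    obtain ⟨hS', s', h'⟩ := exists_isGaugeOn_Ici_one hc hw hT' hS h
    refine Or.inr ⟨hw, hS', ?_⟩
    rw [hw] at h'
    rcases hb with rfl | rfl
    · exact ⟨s', h'⟩
    · exact ⟨_, h'.trans (isGaugeOn_degreeUnit.mono fun t (ht : 1 ≤ t) => by
        rw [Set.mem_compl_singleton_iff]; lia)⟩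
  · obtain ⟨hS', s', h'⟩ := exists_isGaugeOn_univ hc hb hS h
    exact Or.inl ⟨hS', b, s', hb, h'⟩

theorem neg_mem_supp_of_isGaugeOn (hc : D.c = 0) (hw : D.wt = 0) (hS : Set.Ici 1 ⊆ D.supp)
    (h : IsGaugeOn (Set.Ici 1) s D.ℓ (density 0 0)) {n : ℤ} (hn : 1 ≤ n) : -n ∈ D.supp := by
  by_contra hcon
  have hcomm := D.comm_neg (n := n + 1) (t := 1) (a := n + 2) (b := -n) (hS Set.self_mem_Ici)
    (by ring) (by ring)
  have h1 := h (n + 1) 1 Set.self_mem_Ici (Set.mem_Ici.2 (by lia))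
  have h2 := h (-(n + 1)) (n + 2) (Set.mem_Ici.2 (by lia)) (Set.mem_Ici.2 (by lia))
  rw [show n + 1 + 1 = n + 2 by ring] at h1
  rw [show -(n + 1) + (n + 2) = 1 by ring] at h2
  rw [D.source _ _ hcon, hc, hw] at hcomm
  simp only [density] at h1 h2
  push_cast at hcomm h1 h2
  refine mul_ne_zero (Int.cast_ne_zero.2 (by lia : n ≠ 0)) (s 1).ne_zero ?_
  linear_combination -s 1 * hcomm + D.ℓ (-(n + 1)) (n + 2) * h1 + h2

theorem lower_mul_raise_across (hc : D.c = 0) (hS : {0}ᶜ ⊆ D.supp)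
    (hneg : ∀ n t, t ≤ -1 → n + t ≤ -1 → D.ℓ n t = t) {i j : ℤ} (hi : 1 ≤ i) (hj : 1 ≤ j) :
    D.ℓ (-j - 1) j * D.ℓ (i + j) (-i) = -(i * j) := by
  have hcomm := D.comm (-j - 1) (i + j) (-i) (hS (by rw [Set.mem_compl_singleton_iff]; lia))
  rw [hc, mul_zero, ite_self, add_zero, hneg (i + j) (-j - 1 + -i) (by lia) (by lia),
    hneg (-j - 1) (-i) (by lia) (by lia), hneg (-j - 1 + (i + j)) _ (by lia) (by lia),
    add_neg_cancel_comm] at hcomm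
  push_cast at hcomm
  linear_combination hcomm

theorem exists_unit_across (hc : D.c = 0) (hS : {0}ᶜ ⊆ D.supp)
    (hpos : ∀ n t, 1 ≤ t → 1 ≤ n + t → D.ℓ n t = t)
    (hneg : ∀ n t, t ≤ -1 → n + t ≤ -1 → D.ℓ n t = t) :
    ∃ κ : ℂˣ, ∀ i j : ℤ, 1 ≤ i → 1 ≤ j →
      D.ℓ (i + j) (-i) = -i * κ ∧ D.ℓ (-i - j) i * κ = i := by
  have down : ∀ i j : ℤ, 1 ≤ i → 1 ≤ j → D.ℓ (-j - 1) j * D.ℓ (i + j) (-i) = -(i * j) :=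
    fun i j => lower_mul_raise_across hc hS hneg
  have up : ∀ i j : ℤ, 1 ≤ i → 1 ≤ j → D.ℓ (j + 1) (-j) * D.ℓ (-i - j) i = -(i * j) := by
    intro i j hi hj
    have h := lower_mul_raise_across (D := D.flip) (neg_eq_zero.2 hc)
      (fun t ht => hS (neg_ne_zero.2 ht)) (fun n t ht hnt => by
        simp only [flip, hpos (-n) (-t) (by lia) (by lia), Int.cast_neg, neg_neg]) hi hj
    simp only [flip, neg_mul_neg, neg_neg] at h
    rwa [neg_sub, sub_neg_eq_add, add_comm 1, neg_add'] at h
  have hκ : -D.ℓ 2 (-1) ≠ 0 := fun h0 => by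
    have h := up 1 1 le_rfl le_rfl
    rw [one_add_one_eq_two, neg_eq_zero.1 h0] at h
    simp at h
  have hup : ∀ i j : ℤ, 1 ≤ i → 1 ≤ j → D.ℓ (i + j) (-i) = -i * -D.ℓ 2 (-1) := by
    intro i j hi hj
    have h := up j 1 hj le_rfl
    rw [one_add_one_eq_two] at h
    push_cast at h
    apply mul_left_cancel₀ (Int.cast_ne_zero.2 (by lia : j ≠ 0) : (j : ℂ) ≠ 0)
    linear_combination -D.ℓ 2 (-1) * down i j hi hj + D.ℓ (i + j) (-i) * h
  refine ⟨Units.mk0 _ hκ, fun i j hi hj => ⟨hup i j hi hj, ?_⟩⟩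
  apply mul_left_cancel₀ (Int.cast_ne_zero.2 (by lia : j ≠ 0) : (j : ℂ) ≠ 0)
  rw [Units.val_mk0]
  linear_combination D.ℓ (-i - j) i * hup j 1 hj le_rfl - up i j hi hj

theorem exists_isGaugeOn_across (hc : D.c = 0) (hS : {0}ᶜ ⊆ D.supp)
    (hpos : ∀ n t, 1 ≤ t → 1 ≤ n + t → D.ℓ n t = t)
    (hneg : ∀ n t, t ≤ -1 → n + t ≤ -1 → D.ℓ n t = t) :
    ∃ s, IsGaugeOn {0}ᶜ s D.ℓ (density 0 0) := by
  obtain ⟨κ, hκ⟩ := exists_unit_across hc hS hpos hneg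
  refine ⟨fun t => if 0 < t then κ else 1, fun n t ht hnt => ?_⟩
  have hdensity : density 0 0 n t = t := by rw [density, zero_add, zero_mul, add_zero]
  beta_reduce
  rw [hdensity]
  rcases lt_or_gt_of_ne (Set.mem_compl_singleton_iff.1 ht) with ht | ht <;>
    rcases lt_or_gt_of_ne (Set.mem_compl_singleton_iff.1 hnt) with hnt | hnt
  · rw [if_neg (by lia), if_neg (by lia), hneg n t (by lia) (by lia), mul_comm]
  · have h := (hκ (-t) (n + t) (by lia) (by lia)).1
    rw [neg_add_cancel_comm_assoc, neg_neg, Int.cast_neg, neg_neg] at h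
    rw [if_neg (by lia), if_pos (by lia), h, Units.val_one, mul_one, mul_comm]
  · have h := (hκ t (-(n + t)) (by lia) (by lia)).2
    rw [show -t - -(n + t) = n by ring] at h
    rw [if_pos (by lia), if_neg (by lia), h, Units.val_one, one_mul]
  · rw [if_pos (by lia), if_pos (by lia), hpos n t (by lia) (by lia), mul_comm]

theorem isPunctured_of_halves (hw : D.wt = 0) (hc : D.c = 0) (hS : {0}ᶜ ⊆ D.supp)
    (hpos : IsGaugeOn (Set.Ici 1) s D.ℓ (density 0 0))
    (hneg : IsGaugeOn (Set.Iic (-1)) s' D.ℓ (density 0 0)) : D.IsPunctured := by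
  let σ : ℤ → ℂˣ := fun t => if 0 < t then s t else s' t
  obtain ⟨r, hr⟩ := exists_isGaugeOn_across (D := D.rescale σ) hc hS
    (fun n t ht hnt => conj_eq_iff.2 <| by
      simpa [σ, density, if_pos (by lia : 0 < t), if_pos (by lia : 0 < n + t)]
        using hpos n t ht hnt)
    (fun n t ht hnt => conj_eq_iff.2 <| by
      simpa [σ, density, if_neg (by lia : ¬ 0 < t), if_neg (by lia : ¬ 0 < n + t)]
        using hneg n t ht hnt)
  exact ⟨hw, hS, σ * r, IsGaugeOn.trans (fun n t _ _ => conj_eq_iff.1 rfl) hr⟩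

theorem classify_of_ray (hT : Set.Ici T ⊆ D.supp) : D.c = 0 ∧ (D.IsGlobal ∨ D.IsPunctured) := by
  obtain ⟨hc, h | ⟨hw, hS, s, h⟩⟩ := ray_dichotomy hT
  · exact ⟨hc, Or.inl h⟩
  refine ⟨hc, ?_⟩
  have hflip : Set.Ici 1 ⊆ D.flip.supp := fun t ht => neg_mem_supp_of_isGaugeOn hc hw hS h ht
  obtain ⟨-, h' | ⟨-, -, s', h'⟩⟩ := ray_dichotomy hflip
  · exact Or.inl h'.of_flip
  · have hneg := isGaugeOn_neg_of_flip (a := 0) (by rwa [neg_zero])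
    rw [Set.neg_Ici] at hneg
    refine Or.inr (isPunctured_of_halves hw hc (fun t ht => ?_) h hneg)
    rcases lt_or_gt_of_ne (Set.mem_compl_singleton_iff.1 ht) with ht | ht
    · simpa only [flip, Set.mem_ofPred_eq, neg_neg] using hflip (Set.mem_Ici.2 (by lia : 1 ≤ -t))
    · exact hS (Set.mem_Ici.2 (by lia))

theorem classify (hne : D.supp.Nonempty) :
    D.c = 0 ∧ (D.supp = {0} ∧ D.wt = 0 ∨ D.IsGlobal ∨ D.IsPunctured) := by
  by_cases hr : ∃ T, Set.Ici T ⊆ D.supp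
  · obtain ⟨T, hT⟩ := hr
    obtain ⟨hc, h⟩ := classify_of_ray hT
    exact ⟨hc, Or.inr h⟩
  by_cases hl : ∃ T, Set.Iic T ⊆ D.supp
  · obtain ⟨T, hT⟩ := hl
    obtain ⟨hc, h⟩ := classify_of_ray (D := D.flip) (T := -T) fun t ht =>
      hT (neg_le.1 (Set.mem_Ici.1 ht))
    exact ⟨neg_eq_zero.1 hc, Or.inr (h.imp IsGlobal.of_flip IsPunctured.of_flip)⟩
  · obtain ⟨hS, hw, hc⟩ := D.supp_eq_singleton_of_no_ray hr hl hne
    exact ⟨hc, Or.inl ⟨hS, hw⟩⟩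

end VirSystem

/-! ### Structure constants over the twisted Heisenberg–Virasoro algebra -/

/-- Structure constants of a weight module over the twisted Heisenberg–Virasoro algebra with weights
in `wt + ℤ`, all of multiplicity at most one: `C_L`, `C_LI`, `C_I` and `I(0)` act by the scalars
`c`, `z`, `k` and `c₀`, and `I(n) v_t = f n t • v_{n+t}`. -/
structure HVSystem extends VirSystem where
  z : ℂ
  k : ℂ
  c₀ : ℂ
  f : ℤ → ℤ → ℂ
  f_source : ∀ n t, t ∉ supp → f n t = 0
  f_target : ∀ n t, n + t ∉ supp → f n t = 0
  f_zero : ∀ t ∈ supp, f 0 t = c₀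
  LI : ∀ m n, ∀ t ∈ supp, ℓ m (n + t) * f n t - f n (m + t) * ℓ m t
    = n * f (m + n) t + if m + n = 0 then ((m : ℂ) ^ 2 - m) * z else 0
  II : ∀ m n, ∀ t ∈ supp, f m (n + t) * f n t - f n (m + t) * f m t
    = if m + n = 0 then (n : ℂ) * k else 0

namespace HVSystem

variable (D : HVSystem) {T : ℤ}

theorem LI_of_z_eq_zero {m n t a b d : ℤ} (hz : D.z = 0) (ht : t ∈ D.supp) (ha : n + t = a)
    (hb : m + t = b) (hd : m + n = d) :
    D.ℓ m a * D.f n t - D.f n b * D.ℓ m t = n * D.f d t := by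
  subst ha hb hd
  rw [D.LI m n t ht, hz, mul_zero, ite_self, add_zero]

theorem II_of_ne {m n t a b : ℤ} (ht : t ∈ D.supp) (ha : n + t = a) (hb : m + t = b)
    (h0 : m + n ≠ 0) : D.f m a * D.f n t = D.f n b * D.f m t := by
  subst ha hb
  rw [← sub_eq_zero, D.II m n t ht, if_neg h0]

/-- The system with respect to the basis `s t • v_t`. -/
def rescale (s : ℤ → ℂˣ) : HVSystem where
  toVirSystem := D.toVirSystem.rescale s
  z := D.z
  k := D.k
  c₀ := D.c₀
  f := conj s D.f
  f_source n t ht := conj_eq_zero_iff.2 (D.f_source n t ht)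
  f_target n t ht := conj_eq_zero_iff.2 (D.f_target n t ht)
  f_zero t ht := by rw [conj_zero_left, D.f_zero t ht]
  LI m n t ht := by
    rw [VirSystem.rescale, conj_mul_conj, conj_mul_conj, add_comm n m, ← sub_mul, ← mul_sub,
      D.LI m n t ht, conj]
    split_ifs with h0
    · rw [h0, zero_add]
      linear_combination (((m : ℂ) ^ 2 - m) * D.z) * (s t).inv_mul
    · ring
  II m n t ht := by
    rw [conj_mul_conj, conj_mul_conj, add_comm n m, ← sub_mul, ← mul_sub, D.II m n t ht]
    split_ifs with h0
    · rw [h0, zero_add]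
      linear_combination (n * D.k : ℂ) * (s t).inv_mul
    · ring

/-- The system of the contragredient module, on which `L(n)` and `I(n)` act by the transposes of
`L(-n)` and `I(-n)`. This is a module only when `C_LI` acts by zero. -/
def contragredient (hz : D.z = 0) : HVSystem where
  toVirSystem := D.toVirSystem.contragredient
  z := 0
  k := D.k
  c₀ := D.c₀
  f := transpose D.f
  f_source _ _ ht := D.f_target _ _ (by rwa [neg_add_cancel_left])
  f_target _ _ ht := D.f_source _ _ ht
  f_zero t ht := by rw [transpose, neg_zero, zero_add, D.f_zero t ht]
  LI m n t _ := by
    simp only [VirSystem.contragredient, transpose, mul_zero, ite_self, add_zero,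
      show m + (n + t) = m + n + t by ring, show n + (m + t) = m + n + t by ring]
    by_cases hmn : m + n + t ∈ D.supp
    · have h := D.LI_of_z_eq_zero (m := -m) (n := -n) (a := m + t) (b := n + t) (d := -(m + n)) hz
        hmn (by ring) (by ring) (by ring)
      push_cast at h
      linear_combination -h
    · simp only [D.source _ _ hmn, D.f_source _ _ hmn, mul_zero, zero_mul, sub_zero]
  II m n t ht := by
    simp only [transpose, show m + (n + t) = m + n + t by ring,
      show n + (m + t) = m + n + t by ring]
    by_cases hmn : m + n + t ∈ D.supp
    · have h := D.II (-n) (-m) (m + n + t) hmn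
      rw [show -m + (m + n + t) = n + t by ring, show -n + (m + n + t) = m + t by ring,
        ← neg_add, add_comm n m] at h
      simp only [neg_eq_zero] at h
      rw [mul_comm (D.f (-m) _), mul_comm (D.f (-n) (m + n + t)), h]
      split_ifs with h0
      · rw [eq_neg_of_add_eq_zero_right h0]
      · rfl
    · have h0 : m + n ≠ 0 := fun h0 => hmn (by rwa [h0, zero_add])
      simp only [D.f_source _ _ hmn, if_neg h0, zero_mul, sub_zero]

/-- The scalar by which the coefficient of `I(-1)` at `v_t` differs from the one on
`A_{a,b,c₀}`. -/
def defect (t : ℤ) : ℂ := D.f (-1) t - D.c₀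

section Ray

variable {D} {b : ℂ} (hS : Set.Ici T ⊆ D.supp)
  (hℓ : ∀ n t, T ≤ t → T ≤ n + t → D.ℓ n t = density D.wt b n t)

include hS hℓ

theorem exists_mul_defect_eq :
    ∃ H, ∀ t : ℤ, T + 1 ≤ t → (D.wt + t + b - 1) * D.defect t = H := by
  refine ⟨(D.wt + (T + 1) + b - 1) * D.defect (T + 1), fun t ht => ?_⟩
  induction t, ht using Int.leInduction with
  | base => push_cast; ring
  | succ t ht ih =>
    have h := D.LI 1 (-1) t (hS (Set.mem_Ici.2 (by lia)))
    rw [show (1 : ℤ) + -1 = 0 by ring, D.f_zero t (hS (Set.mem_Ici.2 (by lia))), if_pos rfl,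
      add_comm 1 t, hℓ _ _ (by lia) (by lia), hℓ _ _ (by lia) (by lia)] at h
    rw [← ih]
    simp only [defect, density] at h ⊢
    push_cast at h ⊢
    linear_combination -h

theorem f_eq_of_defect {n t : ℤ} (ht : T + 1 ≤ t) (hnt : T ≤ n + t) :
    D.f n t = D.c₀ + (D.wt + t + b * (n + 1)) * D.defect (n + 1 + t)
      - (D.wt + t - 1 + b * (n + 1)) * D.defect t := by
  have h := D.LI (n + 1) (-1) t (hS (Set.mem_Ici.2 (by lia)))
  have hz : (if n = 0 then (((n + 1 : ℤ) : ℂ) ^ 2 - (n + 1 : ℤ)) * D.z else 0) = 0 := by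
    rw [ite_eq_right_iff]
    rintro rfl
    simp
  rw [show n + 1 + -1 = n by ring, hz, hℓ _ _ (by lia) (by lia), hℓ _ _ (by lia) (by lia)] at h
  simp only [defect, density] at h ⊢
  push_cast at h
  linear_combination h

end Ray

section Functions

variable {D} (hS : Set.Ici T ⊆ D.supp)
  (hℓ : ∀ n t, T ≤ t → T ≤ n + t → D.ℓ n t = density D.wt 0 n t)

include hS hℓ

theorem exists_mul_f_eq : ∃ H, ∀ n t : ℤ, T + 1 ≤ t → T ≤ n + t →
    (D.wt + t + n) * D.f n t = (D.wt + t + n) * D.c₀ - n * H := by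
  obtain ⟨H, hH⟩ := exists_mul_defect_eq hS hℓ
  refine ⟨H, fun n t ht hnt => ?_⟩
  have ht' := hH t ht
  have hnt' := hH (n + 1 + t) (by lia)
  rw [f_eq_of_defect hS hℓ ht hnt]
  push_cast at hnt'
  linear_combination (D.wt + t) * hnt' - (D.wt + t + n) * ht'

variable {H : ℂ} (hf : ∀ n t : ℤ, T + 1 ≤ t → T ≤ n + t →
  (D.wt + t + n) * D.f n t = (D.wt + t + n) * D.c₀ - n * H)

include hf

theorem z_eq_zero_of_mul_f_eq : D.z = 0 := by
  have h := D.LI (-2) 2 (T + 3) (hS (Set.mem_Ici.2 (by lia)))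
  rw [neg_add_cancel, D.f_zero _ (hS (Set.mem_Ici.2 (by lia))), if_pos rfl,
    hℓ _ _ (by lia) (by lia), hℓ _ _ (by lia) (by lia)] at h
  have h₁ := hf 2 (T + 3) (by lia) (by lia)
  have h₂ := hf 2 (-2 + (T + 3)) (by lia) (by lia)
  simp only [density] at h
  push_cast at h h₁ h₂
  linear_combination (h₁ - h₂ - h) / 6

omit hℓ in
theorem eq_zero_or_eq_c₀_of_mul_f_eq : H = 0 ∨ H = D.c₀ := by
  have h := D.II_of_ne (m := 2) (n := 1) (t := T + 1) (hS (Set.mem_Ici.2 (by lia))) rfl rfl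
    (by norm_num)
  have h₁ := hf 1 (T + 1) (by lia) (by lia)
  have h₂ := hf 2 (T + 1) (by lia) (by lia)
  have h₃ := hf 2 (1 + (T + 1)) (by lia) (by lia)
  have h₄ := hf 1 (2 + (T + 1)) (by lia) (by lia)
  push_cast at h₁ h₂ h₃ h₄
  have hprod : H * (H - D.c₀) = 0 := by
    linear_combination ((D.wt + T + 2) * (D.wt + T + 3) * (D.wt + T + 4) * h
      - (D.wt + T + 3) * (((D.wt + T + 2) * D.c₀ - H) * h₃
        + (D.wt + T + 4) * D.f 2 (1 + (T + 1)) * h₁)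
      + (D.wt + T + 2) * (((D.wt + T + 3) * D.c₀ - 2 * H) * h₄
        + (D.wt + T + 4) * D.f 1 (2 + (T + 1)) * h₂)) / 2
  exact (mul_eq_zero.1 hprod).imp_right sub_eq_zero.1

omit hℓ in
theorem k_eq_zero_of_mul_f_eq : D.k = 0 := by
  have hH : H * (H - D.c₀) = 0 := mul_eq_zero.2
    ((eq_zero_or_eq_c₀_of_mul_f_eq hS hf).imp_right sub_eq_zero.2)
  obtain ⟨t, hTt, h0⟩ : ∃ t ≥ T + 2, ∀ u ≥ t - 1, D.wt + u ≠ 0 := by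
    obtain ⟨u, hu⟩ := exists_ne_zero_from D.wt
    exact ⟨max (T + 2) (u + 1), le_max_left _ _, fun v hv => hu v (by lia)⟩
  have h₀ := h0 t (by lia)
  have hsucc := h0 (t + 1) (by lia)
  have hpred := h0 (t - 1) (by lia)
  have h := D.II (-1) 1 t (hS (Set.mem_Ici.2 (by lia)))
  rw [neg_add_cancel, if_pos rfl] at h
  have h₁ := hf 1 t (by lia) (by lia)
  have h₂ := hf (-1) t (by lia) (by lia)
  have h₃ := hf (-1) (1 + t) (by lia) (by lia)
  have h₄ := hf 1 (-1 + t) (by lia) (by lia)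
  push_cast at hsucc hpred h h₁ h₂ h₃ h₄
  refine (mul_eq_zero.1 ?_).resolve_left (mul_ne_zero (mul_ne_zero h₀ hsucc) hpred)
  linear_combination 2 * hH - (D.wt + t) * (D.wt + (t + 1)) * (D.wt + (t - 1)) * h
    + (D.wt + t - 1) * (((D.wt + t + 1) * D.c₀ - H) * h₃
      + (D.wt + t) * D.f (-1) (1 + t) * h₁)
    - (D.wt + t + 1) * (((D.wt + t - 1) * D.c₀ + H) * h₄
      + (D.wt + t) * D.f 1 (-1 + t) * h₂)

omit hf in
theorem of_functions_on_ray : D.z = 0 ∧ D.k = 0 ∧ ∃ H, (H = 0 ∨ H = D.c₀) ∧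
    ∀ n t : ℤ, T + 1 ≤ t → T ≤ n + t →
      (D.wt + t + n) * D.f n t = (D.wt + t + n) * D.c₀ - n * H := by
  obtain ⟨H, hf⟩ := exists_mul_f_eq hS hℓ
  exact ⟨z_eq_zero_of_mul_f_eq hS hℓ hf, k_eq_zero_of_mul_f_eq hS hf, H,
    eq_zero_or_eq_c₀_of_mul_f_eq hS hf, hf⟩

end Functions

section Density

variable {D} {b : ℂ} (hS : Set.Ici T ⊆ D.supp)
  (hℓ : ∀ n t, T ≤ t → T ≤ n + t → D.ℓ n t = density D.wt b n t)

include hS hℓ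

theorem defect_relation {t : ℤ} (ht : T + 2 ≤ t) :
    (D.wt + t + 1 - b) * ((D.wt + t + 2 * b) * D.defect (t + 2)
      - (D.wt + t - 1 + 2 * b) * D.defect t)
      - (D.wt + t - b) * ((D.wt + t - 1 + 2 * b) * D.defect (t + 1)
        - (D.wt + t - 2 + 2 * b) * D.defect (t - 1)) = 2 * D.z := by
  have h := D.LI (-1) 1 t (hS (Set.mem_Ici.2 (by lia)))
  rw [neg_add_cancel, D.f_zero t (hS (Set.mem_Ici.2 (by lia))), if_pos rfl,
    hℓ _ _ (by lia) (by lia), hℓ _ _ (by lia) (by lia),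
    f_eq_of_defect hS hℓ (by lia) (by lia), f_eq_of_defect hS hℓ (by lia) (by lia),
    show 1 + 1 + t = t + 2 by ring, show 1 + 1 + (-1 + t) = t + 1 by ring,
    show -1 + t = t - 1 by ring] at h
  simp only [density] at h
  push_cast at h
  linear_combination h

variable {H : ℂ} (hH : ∀ t : ℤ, T + 1 ≤ t → (D.wt + t + b - 1) * D.defect t = H)

include hH

/-- Clearing denominators in `defect_relation`, with `y = wt + t + b` and
`defect t = H / (y - 1)`. -/
theorem quartic_of_defect {t : ℤ} {y : ℂ} (ht : T + 2 ≤ t) (hy : D.wt + t + b = y) :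
    2 * D.z * y ^ 4 - 4 * D.z * y ^ 3 - 2 * D.z * y ^ 2
      + (4 * D.z - 8 * (H * b * (1 - b))) * y + 4 * (H * b * (1 - b)) = 0 := by
  have h := defect_relation hS hℓ ht
  have hy' (i : ℤ) (hi : T + 1 ≤ t + i) : (y - 1 + i) * D.defect (t + i) = H := by
    rw [← hy, ← hH _ hi]
    push_cast
    ring
  have h₀ := hy' (-1) (by lia)
  have h₁ := hy' 0 (by lia)
  have h₂ := hy' 1 (by lia)
  have h₃ := hy' 2 (by lia)
  rw [← sub_eq_add_neg] at h₀
  rw [add_zero] at h₁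
  rw [show D.wt + t = y - b by rw [← hy, add_sub_cancel_right]] at h
  push_cast at h₀ h₁ h₂ h₃
  linear_combination -((y - 2) * (y - 1) * y * (y + 1) * h)
    + (y + 1 - 2 * b) * ((y + b) * ((y - 2) * (y - 1) * y) * h₃
      - (y - 1 + b) * ((y - 2) * y * (y + 1)) * h₁)
    - (y - 2 * b) * ((y - 1 + b) * ((y - 2) * (y - 1) * (y + 1)) * h₂
      - (y - 2 + b) * ((y - 1) * y * (y + 1)) * h₀)

theorem z_eq_zero_and_defect_eq_zero (hb₀ : b ≠ 0) (hb₁ : b ≠ 1) : D.z = 0 ∧ H = 0 := by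
  have hinf := infinite_setOf_of_progression (d := 1) (D.wt + (T + 2) + b)
    (P := fun y => 2 * D.z * y ^ 4 - 4 * D.z * y ^ 3 - 2 * D.z * y ^ 2
      + (4 * D.z - 8 * (H * b * (1 - b))) * y + 4 * (H * b * (1 - b)) = 0)
    one_ne_zero fun j => quartic_of_defect hS hℓ hH
      (t := T + 2 + j) (by lia) (by push_cast; ring)
  have hcoeff := eq_zero_of_infinite_roots (a := ![4 * (H * b * (1 - b)),
    4 * D.z - 8 * (H * b * (1 - b)), -2 * D.z, -4 * D.z, 2 * D.z]) <| hinf.mono fun y hy => by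
      rw [Set.mem_ofPred_eq] at hy ⊢
      simp [Fin.sum_univ_five]
      linear_combination hy
  have hz : D.z = 0 := by simpa using hcoeff 4
  have hH0 : H * b * (1 - b) = 0 := by simpa using hcoeff 0
  exact ⟨hz, by simpa [hb₀, sub_eq_zero, hb₁.symm] using hH0⟩

omit hH in
theorem z_eq_zero_and_f_eq_of_density (hb₀ : b ≠ 0) (hb₁ : b ≠ 1) :
    D.z = 0 ∧ ∀ n t : ℤ, T + 2 ≤ t → T + 1 ≤ n + t → D.f n t = D.c₀ := by
  obtain ⟨H, hH⟩ := exists_mul_defect_eq hS hℓ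
  obtain ⟨hz, rfl⟩ := z_eq_zero_and_defect_eq_zero hS hℓ hH hb₀ hb₁
  have hne (t : ℤ) (ht : T + 1 ≤ t) (h0 : D.wt + t + b - 1 ≠ 0) : D.defect t = 0 :=
    (mul_eq_zero.1 (hH t ht)).resolve_left h0
  have hdefect (t : ℤ) (ht : T + 2 ≤ t) : D.defect t = 0 := by
    by_cases h0 : D.wt + t + b - 1 = 0
    · have h := defect_relation hS hℓ ht
      have hw : D.wt = 1 - b - t := by linear_combination h0
      rw [hne (t + 2) (by lia), hne (t + 1) (by lia), hne (t - 1) (by lia), hz, hw] at h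
      · have hb : b * (1 - b) * D.defect t = 0 := by linear_combination -h / 2
        exact (mul_eq_zero.1 hb).resolve_left (mul_ne_zero hb₀ (sub_ne_zero.2 hb₁.symm))
      all_goals
        push_cast
        rw [hw]
        ring_nf
        norm_num
    · exact hne t (by lia) h0
  refine ⟨hz, fun n t ht hnt => ?_⟩
  rw [f_eq_of_defect hS hℓ (by lia) (by lia), hdefect t ht, hdefect _ (by lia)]
  ring

end Density

/-- In a suitable basis, the structure constants are those of the module `p` of the list. -/
def IsModel (p : Param) : Prop :=
  D.supp = Set.univ ∧ D.c = 0 ∧ D.z = 0 ∧ D.k = 0 ∧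
    ∃ s, IsGaugeOn Set.univ s D.ℓ p.coeffs.ℓ ∧ IsGaugeOn Set.univ s D.f p.coeffs.f

variable {D} {p : Param} {s : ℤ → ℂˣ}

theorem IsModel.of_rescale (h : (D.rescale s).IsModel p) : D.IsModel p := by
  obtain ⟨hS, hc, hz, hk, r, hr, hr'⟩ := h
  exact ⟨hS, hc, hz, hk, s * r, (isGaugeOn_conj _ _ _).trans hr, (isGaugeOn_conj _ _ _).trans hr'⟩

theorem isModel_of_eq (hS : D.supp = Set.univ) (hc : D.c = 0) (hz : D.z = 0) (hk : D.k = 0)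
    (hℓ : D.ℓ = p.coeffs.ℓ) (hf : D.f = p.coeffs.f) : D.IsModel p :=
  ⟨hS, hc, hz, hk, 1, hℓ ▸ .refl _ _, hf ▸ .refl _ _⟩

theorem isModel_of_density {b : ℂ} (hS : D.supp = Set.univ) (hc : D.c = 0) (hb₀ : b ≠ 0)
    (hb₁ : b ≠ 1) (hℓ : D.ℓ = density D.wt b) : D.IsModel (.A D.wt b D.c₀) := by
  have h (T : ℤ) := z_eq_zero_and_f_eq_of_density (T := T) (hS ▸ Set.subset_univ _)
    (fun n t _ _ => by rw [hℓ]) hb₀ hb₁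
  have hf (n t : ℤ) : D.f n t = D.c₀ :=
    (h (min (t - 2) (n + t - 1))).2 n t (by lia) (by lia)
  have hk : D.k = 0 := by
    have hII := D.II (-1) 1 0 (hS ▸ Set.mem_univ _)
    rw [hf, hf, hf, hf, sub_self, neg_add_cancel, if_pos rfl, Int.cast_one, one_mul] at hII
    exact hII.symm
  exact isModel_of_eq hS hc (h 0).1 hk hℓ (funext₂ hf)

theorem of_functions (hS : D.supp = Set.univ) (hℓ : D.ℓ = density D.wt 0) :
    D.z = 0 ∧ D.k = 0 ∧ ∃ H, (H = 0 ∨ H = D.c₀) ∧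
      ∀ n t : ℤ, (D.wt + t + n) * D.f n t = (D.wt + t + n) * D.c₀ - n * H := by
  have hray (T : ℤ) := of_functions_on_ray (T := T) (hS ▸ Set.subset_univ _)
    fun n t _ _ => by rw [hℓ]
  obtain ⟨hz, hk, H, hH, h0⟩ := hray 0
  refine ⟨hz, hk, H, hH, fun n t => ?_⟩
  obtain ⟨-, -, H', -, h'⟩ := hray (min 0 (min (t - 1) (n + t)))
  have h₁ := h0 (-1) 2 (by lia) (by lia)
  rw [h' (-1) 2 (by lia) (by lia)] at h₁
  obtain rfl : H' = H := by simpa using h₁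
  exact h' n t (by lia) (by lia)

theorem exists_isModel_of_functions (hS : D.supp = Set.univ) (hc : D.c = 0)
    (hwt : ∀ t : ℤ, D.wt + t ≠ 0) (hℓ : D.ℓ = density D.wt 0) : ∃ p, D.IsModel p := by
  have hwt' (n t : ℤ) : D.wt + t + n ≠ 0 := by
    have := hwt (t + n)
    rwa [Int.cast_add, ← add_assoc] at this
  obtain ⟨hz, hk, H, rfl | rfl, hf⟩ := of_functions hS hℓ
  · refine ⟨.A D.wt 0 D.c₀, isModel_of_eq hS hc hz hk hℓ (funext₂ fun n t => ?_)⟩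
    exact mul_left_cancel₀ (hwt' n t) (by rw [hf, mul_zero, sub_zero]; rfl)
  · refine ⟨.A D.wt 1 D.c₀, hS, hc, hz, hk, fun t => (Units.mk0 _ (hwt t))⁻¹,
      fun n t _ _ => ?_, fun n t _ _ => ?_⟩
    all_goals
      rw [Units.mul_inv_eq_iff_eq_mul, mul_assoc, Units.eq_inv_mul_iff_mul_eq, Units.val_mk0,
        Units.val_mk0]
      simp only [Param.coeffs, coeffsA, hℓ, density]
    · push_cast
      ring
    · push_cast
      linear_combination hf n t

theorem exists_isModel_of_isGlobal (hc : D.c = 0) (h : D.IsGlobal) : ∃ p, D.IsModel p := by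
  obtain ⟨hS, b, s, hb, h⟩ := h
  have hwt (hb' : b = 0 ∨ b = 1) : ∀ t : ℤ, D.wt + t ≠ 0 :=
    D.normalized.resolve_left fun h0 => hb ⟨h0, hb'⟩
  have hℓ : (D.rescale s).ℓ = density D.wt b := funext₂ fun n t =>
    conj_eq_iff.2 (h n t trivial trivial)
  by_cases hb₀ : b = 0
  · subst hb₀
    obtain ⟨p, hp⟩ := exists_isModel_of_functions (D := D.rescale s) hS hc (hwt (.inl rfl)) hℓ
    exact ⟨p, hp.of_rescale⟩
  by_cases hb₁ : b = 1
  · subst hb₁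
    let r (t : ℤ) : ℂˣ := Units.mk0 (D.wt + t) (hwt (.inr rfl) t)
    have hr : ((D.rescale s).rescale r).ℓ = density D.wt 0 := funext₂ fun n t => by
      refine conj_eq_iff.2 ?_
      rw [hℓ]
      simp only [density, r, Units.val_mk0]
      push_cast
      ring
    obtain ⟨p, hp⟩ := exists_isModel_of_functions (D := (D.rescale s).rescale r) hS hc
      (hwt (.inr rfl)) hr
    exact ⟨p, hp.of_rescale.of_rescale⟩
  · exact ⟨_, (isModel_of_density (D := D.rescale s) hS hc hb₀ hb₁ hℓ).of_rescale⟩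

end HVSystem

section Cocycles

variable {φ ψ : ℤ → ℂ}

theorem exists_affine_of_cocycle
    (h : ∀ m n : ℤ, m ≠ 0 → n ≠ 0 → m + n ≠ 0 → n * φ n - m * φ m = (n - m) * φ (m + n)) :
    ∃ α β : ℂ, ∀ n : ℤ, n ≠ 0 → φ n = α * n + β := by
  let χ (n : ℤ) : ℂ := φ n - ((φ 2 - φ 1) * n + (2 * φ 1 - φ 2))
  have hχ (m n : ℤ) (hm : m ≠ 0) (hn : n ≠ 0) (hmn : m + n ≠ 0) :
      n * χ n - m * χ m = (n - m) * χ (m + n) := by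
    simp only [χ]
    push_cast
    linear_combination h m n hm hn hmn
  have h1 : χ 1 = 0 := by
    simp only [χ]
    push_cast
    ring
  have h2 : χ 2 = 0 := by
    simp only [χ]
    push_cast
    ring
  have hpos (n : ℤ) (hn : 2 ≤ n) : χ n = 0 := by
    induction n, hn using Int.leInduction with
    | base => exact h2
    | succ n hn ih =>
      have hne : (n : ℂ) - 1 ≠ 0 := by
        rw [sub_ne_zero]
        exact_mod_cast (by lia : n ≠ 1)
      have hn' := hχ 1 n one_ne_zero (by lia) (by lia)
      rw [ih, h1, add_comm 1 n, Int.cast_one] at hn'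
      exact (mul_eq_zero.1 (by linear_combination -hn')).resolve_left hne
  refine ⟨_, _, fun n hn => sub_eq_zero.1 (?_ : χ n = 0)⟩
  obtain hn' | rfl | hn' : 2 ≤ n ∨ n = 1 ∨ n < 0 := by lia
  · exact hpos n hn'
  · exact h1
  · have hn₁ := hχ (1 - n) n (by lia) hn (by lia)
    rw [hpos (1 - n) (by lia), sub_add_cancel, h1] at hn₁
    exact (mul_eq_zero.1 (by linear_combination hn₁)).resolve_left (Int.cast_ne_zero.2 hn)

theorem forall_eq_zero_or_of_mul_eq_zero {α β : ℂ}
    (hψ : ∀ n : ℤ, ψ n = n * (α * n + β))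
    (h : ∀ m n : ℤ, m ≠ 0 → n ≠ 0 → m ≠ n → φ m * ψ n = 0) :
    (∀ n ≠ 0, φ n = 0) ∨ ∀ n ≠ 0, ψ n = 0 := by
  by_contra! hcon
  obtain ⟨⟨m, hm, hφm⟩, n, hn, hψn⟩ := hcon
  have hroot (j : ℤ) (hj : j ≠ 0) (hjm : m ≠ j) : β + α * j = 0 := by
    have hj' := (mul_eq_zero.1 (h m j hm hj hjm)).resolve_left hφm
    rw [hψ j] at hj'
    linear_combination (mul_eq_zero.1 hj').resolve_left (Int.cast_ne_zero.2 hj)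
  have h₁ := hroot (|m| + 1) (by grind) (by grind)
  have h₂ := hroot (|m| + 2) (by grind) (by grind)
  push_cast at h₁ h₂
  have hα : α = 0 := by linear_combination h₂ - h₁
  refine hψn ?_
  rw [hψ n]
  linear_combination (n : ℂ) * h₁ + n * (n - ((|m| : ℤ) : ℂ) - 1) * hα

end Cocycles

theorem isGaugeOn_update_zero {A B : ℤ → ℤ → ℂ} {κ : ℂˣ} (hA : ∀ n, A n 0 = 0)
    (hB : ∀ n, B n 0 = 0) (h : ∀ n t, t ≠ 0 → n + t ≠ 0 → A n t = B n t)
    (hκ : ∀ n, A n (-n) = κ * B n (-n)) :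
    IsGaugeOn Set.univ (Function.update 1 0 κ) A B := by
  have hX : IsGaugeOn {0}ᶜ 1 A B := fun n t ht hnt => by
    rw [h n t ht hnt, mul_comm]
    rfl
  refine (hX.insert (κ := κ) (T := 0) (by simp) (by rw [hA, hB]) (fun u _ => ?_)
    (fun t _ => ?_)).mono fun t _ => em (t = 0)
  · rw [hA, hB, zero_mul, mul_zero]
  · rw [zero_sub]
    simpa using hκ (-t)

theorem degreeUnit_zero : ((degreeUnit 0 : ℂˣ) : ℂ) = 1 := by
  rw [degreeUnit, dif_pos rfl, Units.val_one]

namespace HVSystem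

variable (D : HVSystem) {s : ℤ → ℂˣ}

/-- The contragredient module, in a basis which identifies the contragredient of `A_{0,0}` with
`A_{0,0}` away from degree `0`. -/
def dual (hz : D.z = 0) : HVSystem := (D.contragredient hz).rescale degreeUnit

theorem dual_ℓ_eq_iff (hz : D.z = 0) {n t : ℤ} {x : ℂ} : (D.dual hz).ℓ n t = x ↔
    D.ℓ (-n) (n + t) * degreeUnit t = degreeUnit (n + t) * x :=
  conj_eq_iff

theorem dual_f_eq_iff (hz : D.z = 0) {n t : ℤ} {x : ℂ} : (D.dual hz).f n t = x ↔
    D.f (-n) (n + t) * degreeUnit t = degreeUnit (n + t) * x :=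
  conj_eq_iff

/-- The basis vectors are normalised so that, away from degree `0`, the Virasoro action is that on
`A_{0,0}`. -/
structure PuncturedForm : Prop where
  wt : D.wt = 0
  c : D.c = 0
  mem : {0}ᶜ ⊆ D.supp
  ℓ_eq : ∀ n t : ℤ, t ≠ 0 → n + t ≠ 0 → D.ℓ n t = t

variable {D}

theorem exists_puncturedForm (hc : D.c = 0) (h : D.IsPunctured) :
    ∃ s, (D.rescale s).PuncturedForm := by
  obtain ⟨hw, hS, s, h⟩ := h
  refine ⟨s, hw, hc, hS, fun n t ht hnt => ?_⟩
  rw [show (D.rescale s).ℓ n t = density 0 0 n t from conj_eq_iff.2 (h n t ht hnt), density]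
  ring

namespace PuncturedForm

theorem of_functions_on_ray (h : D.PuncturedForm) : D.z = 0 ∧ D.k = 0 ∧ ∃ H,
    (H = 0 ∨ H = D.c₀) ∧
      ∀ n t : ℤ, 2 ≤ t → 1 ≤ n + t → (t + n) * D.f n t = (t + n) * D.c₀ - n * H := by
  have hray := HVSystem.of_functions_on_ray (D := D) (T := 1)
    (fun t ht => h.mem (by simp at ht ⊢; lia)) fun n t ht hnt => by
      rw [h.ℓ_eq n t (by lia) (by lia), density, h.wt]
      ring
  simpa only [h.wt, zero_add, one_add_one_eq_two] using hray

theorem z_eq_zero (h : D.PuncturedForm) : D.z = 0 := h.of_functions_on_ray.1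

theorem k_eq_zero (h : D.PuncturedForm) : D.k = 0 := h.of_functions_on_ray.2.1

theorem supp_eq_univ (h : D.PuncturedForm) (h0 : 0 ∈ D.supp) : D.supp = Set.univ :=
  Set.eq_univ_of_forall fun t => (em (t = 0)).elim (fun e => e ▸ h0) fun ht => h.mem ht

theorem ℓ_zero_zero (h : D.PuncturedForm) : D.ℓ 0 0 = 0 := by
  by_cases h0 : 0 ∈ D.supp
  · rw [D.zero 0 h0, h.wt, Int.cast_zero, add_zero]
  · exact D.source 0 0 h0

theorem f_eq_zero (h : D.PuncturedForm) (hc₀ : D.c₀ = 0) {n t : ℤ} (ht : t ≠ 0)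
    (hnt : n + t ≠ 0) : D.f n t = 0 := by
  obtain ⟨hz, -, H, hH, hf⟩ := h.of_functions_on_ray
  obtain rfl : H = 0 := hH.elim id fun e => e.trans hc₀
  have hray (n t : ℤ) (ht : 2 ≤ t) (hnt : 1 ≤ n + t) : D.f n t = 0 := by
    have hne : (t : ℂ) + n ≠ 0 := by exact_mod_cast (by lia : t + n ≠ 0)
    exact (mul_eq_zero.1 (by rw [hf n t ht hnt, hc₀]; ring)).resolve_left hne
  have hshift (j i : ℤ) (hjt : j + t ≠ 0) (hi : 1 ≤ i + t) (hij : 2 ≤ i - j + t) :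
      (j + t) * D.f j t = j * D.f i t := by
    have hLI := D.LI_of_z_eq_zero (m := i - j) (n := j) hz (h.mem ht) rfl rfl (sub_add_cancel i j)
    rw [hray j _ hij (by lia), h.ℓ_eq _ (j + t) hjt (by lia)] at hLI
    push_cast at hLI
    linear_combination hLI
  let J := |n| + |t| + 2
  have hJ : D.f (3 * J) t = 0 := by
    have h₁ := hshift J (3 * J) (by grind) (by grind) (by grind)
    rw [hshift J (5 * J) (by grind) (by grind) (by grind)] at h₁
    have hJ0 : (J : ℂ) ≠ 0 := by exact_mod_cast (by grind : J ≠ 0)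
    have h₂ := hshift (3 * J) (5 * J) (by grind) (by grind) (by grind)
    rw [mul_left_cancel₀ hJ0 h₁] at h₂
    push_cast at h₂
    exact (mul_eq_zero.1 (by linear_combination h₂)).resolve_left (Int.cast_ne_zero.2 ht)
  have hn := hshift n (3 * J) hnt (by grind) (by grind)
  rw [hJ, mul_zero] at hn
  exact (mul_eq_zero.1 hn).resolve_left (by exact_mod_cast hnt)

theorem c₀_eq_zero_of_zero_notMem (h : D.PuncturedForm) (h0 : 0 ∉ D.supp) : D.c₀ = 0 := by
  obtain ⟨-, -, H, hH, hf⟩ := h.of_functions_on_ray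
  have hII := D.II_of_ne (m := -2) (n := 3) (t := 2) (a := 5) (b := 0)
    (h.mem two_ne_zero) rfl rfl (by norm_num)
  rw [D.f_source 3 0 h0, zero_mul] at hII
  have h₁ := hf (-2) 5 (by norm_num) (by norm_num)
  have h₂ := hf 3 2 (by norm_num) (by norm_num)
  push_cast at h₁ h₂
  rcases hH with rfl | rfl
  · refine pow_eq_zero_iff two_ne_zero |>.1 ?_
    linear_combination hII - D.f 3 2 * h₁ / 3 - D.c₀ * h₂ / 5
  · refine pow_eq_zero_iff two_ne_zero |>.1 ?_
    linear_combination 3 / 2 * hII - D.f 3 2 * h₁ / 2 - D.c₀ * h₂ / 2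

theorem dual (h : D.PuncturedForm) (hz : D.z = 0) : (D.dual hz).PuncturedForm where
  wt := h.wt
  c := h.c
  mem := h.mem
  ℓ_eq n t ht hnt := by
    rw [dual_ℓ_eq_iff, coe_degreeUnit ht, coe_degreeUnit hnt,
      h.ℓ_eq (-n) (n + t) hnt (by rwa [neg_add_cancel_left])]

section Zero

variable (h : D.PuncturedForm) (h0 : 0 ∈ D.supp)

include h h0

theorem exists_ℓ_source_eq : ∃ α β : ℂ, ∀ n : ℤ, n ≠ 0 → D.ℓ n 0 = α * n + β :=
  exists_affine_of_cocycle fun m n hm hn hmn => by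
    have hcomm := D.comm_of_ne h0 (add_zero n) (add_zero m) rfl hmn
    rwa [h.ℓ_eq m n hn (by rwa [add_comm] at hmn ⊢), h.ℓ_eq n m hm (by rwa [add_comm])] at hcomm

theorem exists_ℓ_target_eq : ∃ α β : ℂ, ∀ n : ℤ, D.ℓ n (-n) = n * (α * n + β) := by
  obtain ⟨α, β, hd⟩ := (h.dual h.z_eq_zero).exists_ℓ_source_eq h0
  refine ⟨α, -β, fun n => ?_⟩
  obtain rfl | hn := eq_or_ne n 0
  · simp [h.ℓ_zero_zero]
  have hn' := neg_ne_zero.2 hn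
  have hℓ := (D.dual_ℓ_eq_iff _).1 (hd (-n) hn')
  rw [add_zero, neg_neg, coe_degreeUnit hn', degreeUnit_zero] at hℓ
  push_cast at hℓ
  linear_combination hℓ

theorem f_source_eq (hf : ∀ n ≠ 1, D.f n (1 - n) * D.ℓ (1 - n) 0 = 0) {n : ℤ} (hn : n ≠ 0) :
    D.f n 0 = D.f 1 0 := by
  obtain rfl | hn1 := eq_or_ne n 1
  · rfl
  have hLI := D.LI_of_z_eq_zero (m := 1 - n) h.z_eq_zero h0 (add_zero n) (add_zero _)
    (sub_add_cancel 1 n)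
  rw [h.ℓ_eq (1 - n) n hn (by simp), hf n hn1, sub_zero] at hLI
  exact mul_left_cancel₀ (Int.cast_ne_zero.2 hn) hLI

theorem exists_f_target_eq (hc₀ : D.c₀ = 0) : ∃ q : ℂ, ∀ n : ℤ, D.f n (-n) = n * q := by
  have hd {n : ℤ} := (h.dual h.z_eq_zero).f_source_eq (n := n) h0 fun n hn => by
    rw [(h.dual h.z_eq_zero).f_eq_zero hc₀ (sub_ne_zero.2 hn.symm) (by simp), zero_mul]
  refine ⟨-(D.dual h.z_eq_zero).f 1 0, fun n => ?_⟩
  obtain rfl | hn := eq_or_ne n 0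
  · simp [D.f_zero 0 h0, hc₀]
  have hn' := neg_ne_zero.2 hn
  have hf := (D.dual_f_eq_iff _).1 (hd hn')
  rw [add_zero, neg_neg, coe_degreeUnit hn', degreeUnit_zero] at hf
  push_cast at hf
  linear_combination hf

theorem ℓ_source_mul_ℓ_target {m n : ℤ} (hm : m ≠ 0) (hn : n ≠ 0) (hmn : m ≠ n) :
    D.ℓ m 0 * D.ℓ n (-n) = 0 := by
  have hcomm := D.comm m n (-n) (h.supp_eq_univ h0 ▸ trivial)
  rw [h.c, mul_zero, ite_self, add_zero, add_neg_cancel, 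
    h.ℓ_eq m (-n) (by lia) (by lia), h.ℓ_eq n (m + -n) (by lia) (by lia),
    h.ℓ_eq (m + n) (-n) (by lia) (by lia)] at hcomm
  push_cast at hcomm
  linear_combination hcomm

theorem ℓ_source_mul_f_target (hc₀ : D.c₀ = 0) {m n : ℤ} (hm : m ≠ 0) (hn : n ≠ 0) (hmn : m ≠ n) :
    D.ℓ m 0 * D.f n (-n) = 0 := by
  have hLI := D.LI_of_z_eq_zero (m := m) (n := n) (t := -n) h.z_eq_zero
    (h.supp_eq_univ h0 ▸ trivial) (add_neg_cancel n) rfl rfl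
  rwa [h.f_eq_zero hc₀ (t := m + -n) (by lia) (by lia),
    h.f_eq_zero hc₀ (n := m + n) (by lia) (by lia), zero_mul, mul_zero, sub_zero] at hLI

theorem f_source_mul_ℓ_target (hc₀ : D.c₀ = 0) {m n : ℤ} (hm : m ≠ 0) (hn : n ≠ 0) (hmn : m ≠ n) :
    D.f m 0 * D.ℓ n (-n) = 0 := by
  have hLI := D.LI_of_z_eq_zero (m := n) (n := m) (t := -n) h.z_eq_zero
    (h.supp_eq_univ h0 ▸ trivial) rfl (add_neg_cancel n) rfl
  rwa [h.f_eq_zero hc₀ (n := m) (by lia) (by lia), h.f_eq_zero hc₀ (n := n + m) (by lia) (by lia),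
    mul_zero, mul_zero, zero_sub, neg_eq_zero] at hLI

theorem f_source_mul_f_target (hc₀ : D.c₀ = 0) {m n : ℤ} (hn : n ≠ 0) (hmn : m ≠ n) :
    D.f m 0 * D.f n (-n) = 0 := by
  have hII := D.II m n (-n) (h.supp_eq_univ h0 ▸ trivial)
  rwa [add_neg_cancel, h.k_eq_zero, mul_zero, ite_self,
    h.f_eq_zero hc₀ (n := m) (t := -n) (by lia) (by lia), mul_zero, sub_zero] at hII

end Zero

end PuncturedForm

end HVSystem

/-- The module `q` is isomorphic to the contragredient of the module `p`. -/
def IsDual (p q : Param) : Prop :=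
  ∃ s, IsGaugeOn Set.univ s (transpose p.coeffs.ℓ) q.coeffs.ℓ ∧
    IsGaugeOn Set.univ s (transpose p.coeffs.f) q.coeffs.f

theorem IsDual.symm {p q : Param} : IsDual p q → IsDual q p := by
  rintro ⟨s, hℓ, hf⟩
  exact ⟨s⁻¹⁻¹, hℓ.of_transpose.symm, hf.of_transpose.symm⟩

theorem isDual_A (a b c : ℂ) : IsDual (.A a b c) (.A a (1 - b) c) :=
  ⟨1, fun n t _ _ => by simp [transpose, Param.coeffs, coeffsA]; ring,
    fun n t _ _ => by simp [transpose, Param.coeffs, coeffsA]⟩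

theorem isDual_A'_B (a d : ℂ) : IsDual (.A' a d) (.B (-a) d) := by
  refine ⟨Function.update 1 0 (-1),
    isGaugeOn_update_zero (fun n => ?_) (fun n => ?_) (fun n t _ hnt => ?_) fun n => ?_,
    isGaugeOn_update_zero (fun n => ?_) (fun n => ?_) (fun n t _ hnt => ?_) fun n => ?_⟩ <;>
    simp_all [transpose, Param.coeffs, coeffsA', coeffsB]
  ring

theorem isDual_U_V (d : ℂ) : IsDual (.U d) (.V (-d)) :=
  ⟨1, fun n t _ _ => by simp [transpose, Param.coeffs, coeffsU, coeffsV, add_comm],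
    fun n t _ _ => by simp [transpose, Param.coeffs, coeffsU, coeffsV]⟩

theorem isDual_U'_V' {d : ℂ} (hd : d ≠ 0) : IsDual (.U' d hd) (.V' (-d) (neg_ne_zero.2 hd)) := by
  refine ⟨degreeUnit, ?_, ?_⟩ <;> intro n t _ _ <;> by_cases ht : t = 0 <;>
    by_cases hnt : n + t = 0 <;>
    simp_all [transpose, Param.coeffs, coeffsU', coeffsV', coe_degreeUnit, degreeUnit_zero,
      mul_comm]

theorem exists_isDual (p : Param) : ∃ q, IsDual p q := by
  cases p with
  | A a b c => exact ⟨_, isDual_A a b c⟩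
  | A' a d => exact ⟨_, isDual_A'_B a d⟩
  | B a d => exact ⟨_, (neg_neg a ▸ isDual_A'_B (-a) d).symm⟩
  | U d => exact ⟨_, isDual_U_V d⟩
  | V d => exact ⟨_, (neg_neg d ▸ isDual_U_V (-d)).symm⟩
  | U' d hd => exact ⟨_, isDual_U'_V' hd⟩
  | V' c hc =>
    have h := (isDual_U'_V' (neg_ne_zero.2 hc)).symm
    simp only [neg_neg] at h
    exact ⟨_, h⟩

namespace HVSystem

variable {D : HVSystem}

theorem exists_isModel_of_contragredient (hz : D.z = 0)
    (h : ∃ p, (D.contragredient hz).IsModel p) : ∃ q, D.IsModel q := by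
  obtain ⟨p, hS, hc, -, hk, s, hℓ, hf⟩ := h
  obtain ⟨q, r, hℓ', hf'⟩ := exists_isDual p
  exact ⟨q, hS, hc, hz, hk, s⁻¹ * r, hℓ.of_transpose.trans hℓ', hf.of_transpose.trans hf'⟩

theorem exists_isModel_of_dual (hz : D.z = 0) (h : ∃ p, (D.dual hz).IsModel p) :
    ∃ q, D.IsModel q :=
  exists_isModel_of_contragredient hz (h.imp fun _ hp => hp.of_rescale)

theorem f_eq_c₀_of_density_zero (hS : D.supp = Set.univ) (hw : D.wt = 0) (hc₀ : D.c₀ ≠ 0)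
    (hℓ : D.ℓ = density 0 0) (n t : ℤ) : D.f n t = D.c₀ := by
  have hmem (t : ℤ) : t ∈ D.supp := hS ▸ trivial
  obtain ⟨hz, -, H, -, hf⟩ := of_functions hS (by rwa [hw])
  have hH : H = 0 := by simpa [hw] using (hf (-1) 1).symm
  have hoff (n t : ℤ) (hnt : n + t ≠ 0) : D.f n t = D.c₀ := by
    have hne : (t : ℂ) + n ≠ 0 := by exact_mod_cast (by lia : t + n ≠ 0)
    have hnt := hf n t
    rw [hw, zero_add, hH, mul_zero, sub_zero] at hnt
    exact mul_left_cancel₀ hne hnt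
  have hconst (m n : ℤ) (hm : m ≠ 0) (hn : n ≠ 0) (hmn : m + n ≠ 0) :
      D.f m (-m) = D.f n (-n) := by
    have hII := D.II_of_ne (m := m) (n := n) (hmem (-m - n)) (a := -m) (b := -n) (by ring)
      (by ring) hmn
    rw [hoff n (-m - n) (by lia), hoff m (-m - n) (by lia)] at hII
    exact mul_right_cancel₀ hc₀ hII
  have h12 : D.f 1 (-1) = D.f 2 (-2) := hconst 1 2 one_ne_zero two_ne_zero (by norm_num)
  have h1 : D.f 1 (-1) = D.c₀ := by
    have hLI := D.LI_of_z_eq_zero (m := 1) (n := 1) (t := -2) hz (hmem _) rfl rfl rfl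
    rw [hoff 1 (-2) (by norm_num), hℓ] at hLI
    norm_num [density] at hLI
    linear_combination hLI - h12
  by_cases hnt : n + t = 0
  · obtain rfl : t = -n := by lia
    rcases eq_or_ne n 0 with rfl | hn
    · exact D.f_zero _ (hmem _)
    rcases eq_or_ne n (-1) with rfl | hn1
    · rw [← hconst 2 (-1) two_ne_zero hn (by norm_num), ← h12, h1]
    · rw [← hconst 1 n one_ne_zero hn (by lia), h1]
  · exact hoff n t hnt

theorem isModel_of_density_zero (hS : D.supp = Set.univ) (hw : D.wt = 0) (hc : D.c = 0)
    (hc₀ : D.c₀ ≠ 0) (hℓ : D.ℓ = density 0 0) : D.IsModel (.A 0 0 D.c₀) := by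
  obtain ⟨hz, hk, -⟩ := of_functions hS (by rwa [hw])
  exact isModel_of_eq hS hc hz hk hℓ (funext₂ (f_eq_c₀_of_density_zero hS hw hc₀ hℓ))

namespace PuncturedForm

theorem isModel_of_source_eq_zero (h : D.PuncturedForm) (hS : D.supp = Set.univ)
    (hℓ : ∀ n, D.ℓ n 0 = 0) (hf : ∀ n, D.f n 0 = 0) (hc₀ : D.c₀ = 0) {p : Param} {κ : ℂˣ}
    (hpℓ : ∀ n, p.coeffs.ℓ n 0 = 0) (hpf : ∀ n, p.coeffs.f n 0 = 0)
    (hpℓ' : ∀ n t, t ≠ 0 → n + t ≠ 0 → p.coeffs.ℓ n t = t)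
    (hpf' : ∀ n t, t ≠ 0 → n + t ≠ 0 → p.coeffs.f n t = 0)
    (hκℓ : ∀ n, D.ℓ n (-n) = κ * p.coeffs.ℓ n (-n))
    (hκf : ∀ n, D.f n (-n) = κ * p.coeffs.f n (-n)) : D.IsModel p := by
  refine ⟨hS, h.c, h.z_eq_zero, h.k_eq_zero, _,
    isGaugeOn_update_zero hℓ hpℓ (fun n t ht hnt => ?_) hκℓ,
    isGaugeOn_update_zero hf hpf (fun n t ht hnt => ?_) hκf⟩
  · rw [h.ℓ_eq n t ht hnt, hpℓ' n t ht hnt]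
  · rw [h.f_eq_zero hc₀ ht hnt, hpf' n t ht hnt]

variable (h : D.PuncturedForm) (h0 : 0 ∈ D.supp)

include h h0

theorem exists_isModel_of_source_eq_zero_of_c₀_ne_zero (hc₀ : D.c₀ ≠ 0)
    (hout : ∀ n ≠ 0, D.ℓ n 0 = 0) : ∃ p, D.IsModel p := by
  have hp {n : ℤ} (hn : n ≠ 0) : D.f n 0 = D.f 1 0 :=
    h.f_source_eq h0 (fun n hn => by rw [hout _ (sub_ne_zero.2 hn.symm), mul_zero]) hn
  have hin {n : ℤ} (hn : n ≠ 0) : D.ℓ n (-n) * D.f 1 0 = -n * D.c₀ := by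
    have hLI := D.LI_of_z_eq_zero (m := n) (n := -n) h.z_eq_zero h0 (add_zero _) (add_zero _)
      (add_neg_cancel n)
    rw [hp (neg_ne_zero.2 hn), hout n hn, mul_zero, sub_zero, D.f_zero 0 h0] at hLI
    push_cast at hLI
    exact hLI
  have hp0 : D.f 1 0 ≠ 0 := fun e => by simpa [e, hc₀] using hin one_ne_zero
  let κ := Units.mk0 (D.c₀ / D.f 1 0) (div_ne_zero hc₀ hp0)
  have hκ : (κ : ℂ) = D.c₀ / D.f 1 0 := Units.val_mk0 _
  refine ⟨_, (isModel_of_density_zero (D := D.rescale (Function.update 1 0 κ))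
    (h.supp_eq_univ h0) h.wt h.c hc₀ (funext₂ fun n t => conj_eq_iff.2 ?_)).of_rescale⟩
  refine isGaugeOn_update_zero (fun n => ?_) (fun n => ?_) (fun n t ht hnt => ?_) (fun n => ?_)
    n t trivial trivial
  · obtain rfl | hn := eq_or_ne n 0
    exacts [h.ℓ_zero_zero, hout n hn]
  · simp [density]
  · rw [h.ℓ_eq n t ht hnt]
    simp [density]
  · obtain rfl | hn := eq_or_ne n 0
    · simp [h.ℓ_zero_zero, density]
    · rw [hκ, ← mul_left_inj' hp0, hin hn]
      simp only [density]
      field_simp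
      push_cast
      ring

theorem exists_isModel_or_of_source_eq_zero (hℓ : ∀ n, D.ℓ n 0 = 0) (hf : ∀ n, D.f n 0 = 0) :
    (∃ p, D.IsModel p) ∨ ∀ n, D.ℓ n (-n) = 0 ∧ D.f n (-n) = 0 := by
  have hc₀ : D.c₀ = 0 := D.f_zero 0 h0 ▸ hf 0
  obtain ⟨α, β, hℓ'⟩ := h.exists_ℓ_target_eq h0
  obtain ⟨q, hf'⟩ := h.exists_f_target_eq h0 hc₀
  have hmodel (p : Param) (κ : ℂˣ) := h.isModel_of_source_eq_zero (p := p) (κ := κ)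
    (h.supp_eq_univ h0) hℓ hf hc₀
  by_cases hα : α = 0
  · by_cases hβ : β = 0
    · by_cases hq : q = 0
      · exact .inr fun n => by simp [hℓ', hf', hα, hβ, hq]
      · refine .inl ⟨.U' q hq, hmodel _ 1 ?_ ?_ ?_ ?_ ?_ ?_⟩ <;>
          simp +contextual [Param.coeffs, coeffsU', hℓ', hf', hα, hβ, mul_comm]
    · refine .inl ⟨.U (-q / β), hmodel _ (-Units.mk0 β hβ) ?_ ?_ ?_ ?_ ?_ fun n => ?_⟩ <;>
        simp +contextual [Param.coeffs, coeffsU, hℓ', hf', hα, mul_comm]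
      field_simp
  · refine .inl ⟨.B (β / α) (-q / α), hmodel _ (-Units.mk0 α hα) ?_ ?_ ?_ ?_ (fun n => ?_)
      fun n => ?_⟩ <;>
      simp +contextual [Param.coeffs, coeffsB, hℓ', hf'] <;> field_simp

end PuncturedForm

/-- The vector of degree `0` spans a direct summand on which the algebra acts by zero. -/
def IsSplit (D : HVSystem) : Prop :=
  D.supp = Set.univ ∧ ∀ n, (D.ℓ n 0 = 0 ∧ D.f n 0 = 0) ∧ D.ℓ n (-n) = 0 ∧ D.f n (-n) = 0

theorem isSplit_rescale_iff {s : ℤ → ℂˣ} : (D.rescale s).IsSplit ↔ D.IsSplit := by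
  refine and_congr_right fun _ => forall_congr' fun n => ?_
  exact and_congr (and_congr conj_eq_zero_iff conj_eq_zero_iff)
    (and_congr conj_eq_zero_iff conj_eq_zero_iff)

theorem isSplit_of_dual (hz : D.z = 0) (h : (D.dual hz).IsSplit) : D.IsSplit := by
  obtain ⟨hS, h⟩ := isSplit_rescale_iff.1 h
  refine ⟨hS, fun n => ?_⟩
  obtain ⟨⟨hℓ, hf⟩, hℓ', hf'⟩ := h (-n)
  simp only [contragredient, VirSystem.contragredient, transpose, neg_neg, add_zero,
    neg_add_cancel] at hℓ hf hℓ' hf'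
  exact ⟨⟨hℓ', hf'⟩, hℓ, hf⟩

namespace PuncturedForm

theorem exists_isModel_or_isSplit_of_source_eq_zero (h : D.PuncturedForm) (h0 : 0 ∈ D.supp)
    (hℓ : ∀ n ≠ 0, D.ℓ n 0 = 0) (hf : D.c₀ = 0 → ∀ n ≠ 0, D.f n 0 = 0) :
    (∃ p, D.IsModel p) ∨ D.IsSplit := by
  by_cases hc₀ : D.c₀ = 0
  · have hℓ' (n : ℤ) : D.ℓ n 0 = 0 := (eq_or_ne n 0).elim (fun e => e ▸ h.ℓ_zero_zero) (hℓ n)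
    have hf' (n : ℤ) : D.f n 0 = 0 :=
      (eq_or_ne n 0).elim (fun e => by rw [e, D.f_zero 0 h0, hc₀]) (hf hc₀ n)
    exact (h.exists_isModel_or_of_source_eq_zero h0 hℓ' hf').imp_right fun h' =>
      ⟨h.supp_eq_univ h0, fun n => ⟨⟨hℓ' n, hf' n⟩, h' n⟩⟩
  · exact .inl (h.exists_isModel_of_source_eq_zero_of_c₀_ne_zero h0 hc₀ hℓ)

theorem exists_isModel_or_isSplit (h : D.PuncturedForm) (h0 : 0 ∈ D.supp) :
    (∃ p, D.IsModel p) ∨ D.IsSplit := by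
  have hz := h.z_eq_zero
  have htarget (hℓ : ∀ n ≠ 0, D.ℓ n (-n) = 0) (hf : D.c₀ = 0 → ∀ n ≠ 0, D.f n (-n) = 0) :
      (∃ p, D.IsModel p) ∨ D.IsSplit := by
    refine ((h.dual hz).exists_isModel_or_isSplit_of_source_eq_zero h0 (fun n hn => ?_)
      fun hc₀ n hn => ?_).imp (exists_isModel_of_dual hz) (isSplit_of_dual hz)
    · rw [dual_ℓ_eq_iff, add_zero, mul_zero]
      have e := hℓ (-n) (neg_ne_zero.2 hn)
      rw [neg_neg] at e
      rw [e, zero_mul]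
    · rw [dual_f_eq_iff, add_zero, mul_zero]
      have e := hf hc₀ (-n) (neg_ne_zero.2 hn)
      rw [neg_neg] at e
      rw [e, zero_mul]
  obtain ⟨α, β, hℓ'⟩ := h.exists_ℓ_target_eq h0
  have hℓℓ := forall_eq_zero_or_of_mul_eq_zero hℓ' fun _ _ hm hn hmn =>
    h.ℓ_source_mul_ℓ_target h0 hm hn hmn
  by_cases hc₀ : D.c₀ = 0
  · obtain ⟨q, hf'⟩ := h.exists_f_target_eq h0 hc₀
    have hfℓ := forall_eq_zero_or_of_mul_eq_zero hℓ' fun _ _ hm hn hmn =>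
      h.f_source_mul_ℓ_target h0 hc₀ hm hn hmn
    have hf'' (n : ℤ) : D.f n (-n) = n * (0 * n + q) := by rw [hf', zero_mul, zero_add]
    have hℓf := forall_eq_zero_or_of_mul_eq_zero hf'' fun _ _ hm hn hmn =>
      h.ℓ_source_mul_f_target h0 hc₀ hm hn hmn
    have hff := forall_eq_zero_or_of_mul_eq_zero hf'' fun _ _ _ hn hmn =>
      h.f_source_mul_f_target h0 hc₀ hn hmn
    obtain ⟨hℓ, hf⟩ | ⟨hℓ, hf⟩ : ((∀ n ≠ 0, D.ℓ n 0 = 0) ∧ ∀ n ≠ 0, D.f n 0 = 0) ∨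
        ((∀ n ≠ 0, D.ℓ n (-n) = 0) ∧ ∀ n ≠ 0, D.f n (-n) = 0) := by tauto
    · exact h.exists_isModel_or_isSplit_of_source_eq_zero h0 hℓ fun _ => hf
    · exact htarget hℓ fun _ => hf
  · obtain hℓ | hℓ := hℓℓ
    · exact h.exists_isModel_or_isSplit_of_source_eq_zero h0 hℓ fun e => absurd e hc₀
    · exact htarget hℓ fun e => absurd e hc₀

end PuncturedForm

/-- The coefficient of the action of a basis element of the algebra on `v_t`. -/
def coeff (D : HVSystem) : Gen → ℤ → ℂ
  | .L n, t => D.ℓ n t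
  | .I n, t => D.f n t
  | .CL, _ => D.c
  | .CI, _ => D.k
  | .CLI, _ => D.z

theorem coeff_eq_zero_of_supp_eq_singleton (hS : D.supp = {0}) (hw : D.wt = 0) (hc : D.c = 0) :
    D.coeff = 0 := by
  have h0 : 0 ∈ D.supp := hS ▸ rfl
  have hℓ (n t : ℤ) : D.ℓ n t = 0 := by
    by_cases ht : t ∈ D.supp
    · obtain rfl : t = 0 := by rwa [hS] at ht
      obtain rfl | hn := eq_or_ne n 0
      · rw [D.zero 0 h0, hw, Int.cast_zero, add_zero]
      · exact D.target n 0 (by rwa [hS, add_zero])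
    · exact D.source n t ht
  have hf (n t : ℤ) (h : n ≠ 0 ∨ t ≠ 0) : D.f n t = 0 := by
    by_cases ht : t = 0
    · exact D.f_target n t (by rw [hS, ht, add_zero]; exact h.resolve_right (not_not.2 ht))
    · exact D.f_source n t (by rwa [hS])
  have hf₀ : D.f 0 0 = 0 := by
    simpa [hℓ, eq_comm (a := (0 : ℂ))] using D.LI 1 (-1) 0 h0
  have hz : D.z = 0 := by
    have h := D.LI (-1) 1 0 h0
    norm_num [hℓ, hf₀] at h
    exact h
  have hk : D.k = 0 := by
    have h := D.II (-1) 1 0 h0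
    norm_num [hf] at h
    exact h.symm
  funext g t
  rcases g with n | n | _ | _ | _
  exacts [hℓ n t, (em (n = 0 ∧ t = 0)).elim (fun e => by rw [coeff, e.1, e.2, hf₀]; rfl)
    fun e => hf n t (not_and_or.1 e), hc, hk, hz]

theorem classify (hne : D.supp.Nonempty) :
    D.coeff = 0 ∨ (∃ p, D.IsModel p) ∨ (∃ s, (D.rescale s).PuncturedForm ∧ 0 ∉ D.supp) ∨
      D.IsSplit := by
  obtain ⟨hc, ⟨hS, hw⟩ | h | h⟩ := D.toVirSystem.classify hne
  · exact .inl (coeff_eq_zero_of_supp_eq_singleton hS hw hc)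
  · exact .inr (.inl (exists_isModel_of_isGlobal hc h))
  obtain ⟨s, hs⟩ := exists_puncturedForm hc h
  by_cases h0 : 0 ∈ D.supp
  · obtain ⟨p, hp⟩ | hsplit := hs.exists_isModel_or_isSplit h0
    · exact .inr (.inl ⟨p, hp.of_rescale⟩)
    · exact .inr (.inr (.inr (isSplit_rescale_iff.1 hsplit)))
  · exact .inr (.inr (.inl ⟨s, hs, h0⟩))

end HVSystem

/-! ### Modules and their structure constants -/

theorem mono_eq_smul (g : Gen) (z : ℂ) : mono g z = z • mono g 1 := by rw [smul_mono, mul_one]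

/-- The degree of a basis element of the algebra, that is, its eigenvalue under `ad L(0)`. -/
def Gen.deg : Gen → ℤ
  | .L m => m
  | .I m => m
  | _ => 0

theorem lie_L_zero (g : Gen) : ⁅mono (.L 0) 1, mono g 1⁆ = (g.deg : ℂ) • mono g 1 := by
  rw [lie_mono, mul_one, one_smul]
  rcases g with m | m | _ | _ | _ <;> simp [bracketGen, Gen.deg, mono_zero, smul_mono]

theorem mono_mem_center {g : Gen} (hg : g = .CL ∨ g = .CI ∨ g = .CLI ∨ g = .I 0) :
    mono g 1 ∈ LieAlgebra.center ℂ Alg := by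
  refine (LieModule.mem_maxTrivSubmodule _ _ _ _).2 fun x => ?_
  induction x using alg_induction with
  | h0 => exact zero_lie _
  | ha x y hx hy => rw [add_lie, hx, hy, add_zero]
  | hs h z =>
    rw [lie_mono]
    rcases hg with rfl | rfl | rfl | rfl <;> rcases h with m | m | _ | _ | _ <;>
      simp [bracketGen, mono_zero]
    by_cases hm : m = 0 <;> simp [mono_zero, hm]

theorem lie_comm_of_mem_center {M : Type*} [AddCommGroup M] [LieRingModule Alg M] {x : Alg}
    (hx : x ∈ LieAlgebra.center ℂ Alg) (y : Alg) (v : M) : ⁅y, ⁅x, v⁆⁆ = ⁅x, ⁅y, v⁆⁆ := by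
  rw [leibniz_lie, (LieModule.mem_maxTrivSubmodule _ _ _ _).1 hx, zero_lie, zero_add]

section Weights

variable {V : Type*} [AddCommGroup V] [Module ℂ V] [LieRingModule Alg V] [LieModule ℂ Alg V]

theorem mem_weightSpace {μ : ℂ} {v : V} : v ∈ weightSpace V μ ↔ ⁅mono (.L 0) 1, v⁆ = μ • v :=
  Module.End.mem_eigenspace_iff

theorem lie_mem_weightSpace {μ : ℂ} {v : V} (hv : v ∈ weightSpace V μ) (g : Gen) :
    ⁅mono g 1, v⁆ ∈ weightSpace V (μ + g.deg) := by
  rw [mem_weightSpace] at hv ⊢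
  rw [leibniz_lie, lie_L_zero, hv, smul_lie, lie_smul, ← add_smul, add_comm]

/-- The sum of the weight spaces with weights in `A`, as a submodule of a module in which no basis
element of the algebra leads out of `A`. -/
def sector (A : Set ℂ) (hA : ∀ g : Gen, ∀ μ ∈ A, ∀ v ∈ weightSpace V μ,
    ⁅mono g 1, v⁆ ≠ 0 → μ + g.deg ∈ A) : LieSubmodule ℂ Alg V where
  toSubmodule := ⨆ μ ∈ A, weightSpace V μ
  lie_mem {x v} hv := by
    change v ∈ ⨆ μ ∈ A, weightSpace V μ at hv
    change ⁅x, v⁆ ∈ ⨆ μ ∈ A, weightSpace V μ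
    induction x using alg_induction with
    | h0 => rw [zero_lie]; exact zero_mem _
    | ha x y hx hy => rw [add_lie]; exact add_mem hx hy
    | hs g z =>
      rw [mono_eq_smul, smul_lie]
      apply Submodule.smul_mem
      suffices ⨆ μ ∈ A, weightSpace V μ ≤
          (⨆ μ ∈ A, weightSpace V μ).comap (LieModule.toEnd ℂ Alg V (mono g 1)) from this hv
      refine iSup₂_le fun μ hμ w hw => ?_
      rw [Submodule.mem_comap, LieModule.toEnd_apply_apply]
      by_cases h0 : ⁅mono g 1, w⁆ = 0
      · rw [h0]; exact zero_mem _
      · exact Submodule.mem_iSup_of_mem _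
          (Submodule.mem_iSup_of_mem (hA g μ hμ w hw h0) (lie_mem_weightSpace hw g))

theorem weightSpace_le_sector {A : Set ℂ} (hA : ∀ g : Gen, ∀ μ ∈ A, ∀ v ∈ weightSpace V μ,
    ⁅mono g 1, v⁆ ≠ 0 → μ + g.deg ∈ A) {μ : ℂ} (hμ : μ ∈ A) :
    weightSpace V μ ≤ (sector A hA).toSubmodule :=
  le_iSup₂_of_le (f := fun μ (_ : μ ∈ A) => weightSpace V μ) μ hμ le_rfl

theorem isCompl_sector (hW : IsWeightModule V) {A : Set ℂ} (hA hA') :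
    IsCompl (sector (V := V) A hA) (sector Aᶜ hA') := by
  rw [← LieSubmodule.isCompl_toSubmodule]
  refine ⟨(Module.End.eigenspaces_iSupIndep _).disjoint_biSup_biSup disjoint_compl_right,
    codisjoint_iff_le_sup.2 (hW.ge.trans (iSup_le fun μ => ?_))⟩
  by_cases hμ : μ ∈ A
  · exact (weightSpace_le_sector hA hμ).trans le_sup_left
  · exact (weightSpace_le_sector hA' hμ).trans le_sup_right

theorem weightSpace_eq_bot_of_indecomposable (hI : IsIndecomposable V) (hW : IsWeightModule V)
    (A : Set ℂ) (hA : ∀ g : Gen, ∀ μ, ∀ v ∈ weightSpace V μ, ⁅mono g 1, v⁆ ≠ 0 →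
      (μ ∈ A ↔ μ + g.deg ∈ A)) :
    (∀ μ ∈ A, weightSpace V μ = ⊥) ∨ ∀ μ ∉ A, weightSpace V μ = ⊥ := by
  have hN (g : Gen) (μ : ℂ) (hμ : μ ∈ A) (v : V) (hv : v ∈ weightSpace V μ)
      (h0 : ⁅mono g 1, v⁆ ≠ 0) : μ + g.deg ∈ A := (hA g μ v hv h0).1 hμ
  have hP (g : Gen) (μ : ℂ) (hμ : μ ∈ Aᶜ) (v : V) (hv : v ∈ weightSpace V μ)
      (h0 : ⁅mono g 1, v⁆ ≠ 0) : μ + g.deg ∈ Aᶜ := fun h => hμ ((hA g μ v hv h0).2 h)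
  refine (hI.2 _ _ (isCompl_sector hW hN hP)).imp (fun h μ hμ => ?_) fun h μ hμ => ?_ <;>
    rw [← le_bot_iff, ← LieSubmodule.bot_toSubmodule (R := ℂ) (L := Alg), ← h]
  exacts [weightSpace_le_sector hN hμ, weightSpace_le_sector hP hμ]

theorem exists_weightSpace_ne_bot (hI : IsIndecomposable V) (hW : IsWeightModule V) :
    ∃ μ, weightSpace V μ ≠ ⊥ := by
  by_contra! h
  have := hI.1
  exact bot_ne_top (α := Submodule ℂ V) (by rw [← hW, iSup_eq_bot.2 h])

theorem exists_weight_mem_coset (hI : IsIndecomposable V) (hW : IsWeightModule V) {μ₀ : ℂ}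
    (hμ₀ : weightSpace V μ₀ ≠ ⊥) {μ : ℂ} (hμ : weightSpace V μ ≠ ⊥) : ∃ t : ℤ, μ = μ₀ + t := by
  obtain h | h := weightSpace_eq_bot_of_indecomposable hI hW {μ | ∃ t : ℤ, μ = μ₀ + t}
    fun g μ _ _ _ => ⟨fun ⟨t, ht⟩ => ⟨t + g.deg, by push_cast; linear_combination ht⟩,
      fun ⟨t, ht⟩ => ⟨t - g.deg, by push_cast; linear_combination ht⟩⟩
  · exact absurd (h μ₀ ⟨0, by simp⟩) hμ₀
  · exact not_not.1 fun hcon => hμ (h μ hcon)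

theorem exists_coset (hI : IsIndecomposable V) (hW : IsWeightModule V) : ∃ wt : ℂ,
    (wt = 0 ∨ ∀ t : ℤ, wt + t ≠ 0) ∧ ∀ μ, weightSpace V μ ≠ ⊥ → ∃ t : ℤ, μ = wt + t := by
  obtain ⟨μ₀, hμ₀⟩ := exists_weightSpace_ne_bot hI hW
  by_cases! h0 : ∃ t : ℤ, μ₀ + t = 0
  · obtain ⟨t₀, ht₀⟩ := h0
    refine ⟨0, .inl rfl, fun μ hμ => ?_⟩
    obtain ⟨t, rfl⟩ := exists_weight_mem_coset hI hW hμ₀ hμ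
    exact ⟨t - t₀, by push_cast; linear_combination ht₀⟩
  · exact ⟨μ₀, .inr h0, fun μ hμ => exists_weight_mem_coset hI hW hμ₀ hμ⟩

theorem exists_generator (hr : ∀ μ, Module.rank ℂ (weightSpace V μ) ≤ 1) (μ : ℂ) :
    ∃ v ∈ weightSpace V μ, ∀ w ∈ weightSpace V μ, ∃ a : ℂ, w = a • v := by
  obtain ⟨v, hv⟩ := rank_le_one_iff.1 (hr μ)
  refine ⟨v, v.2, fun w hw => ?_⟩
  obtain ⟨a, ha⟩ := hv ⟨w, hw⟩
  exact ⟨a, by rw [← SetLike.val_smul, ha]⟩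

theorem eq_smul_of_rank_le_one (hr : ∀ μ, Module.rank ℂ (weightSpace V μ) ≤ 1) {μ : ℂ} {v w : V}
    (hv : v ∈ weightSpace V μ) (hv0 : v ≠ 0) (hw : w ∈ weightSpace V μ) : ∃ a : ℂ, w = a • v := by
  obtain ⟨x, -, hgen⟩ := exists_generator hr μ
  obtain ⟨a, rfl⟩ := hgen v hv
  obtain ⟨b, rfl⟩ := hgen w hw
  have ha : a ≠ 0 := fun h => hv0 (by rw [h, zero_smul])
  exact ⟨b / a, by rw [smul_smul, div_mul_cancel₀ _ ha]⟩

theorem lie_mem_weightSpace_of_mem_center {x : Alg} (hx : x ∈ LieAlgebra.center ℂ Alg) {μ : ℂ}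
    {v : V} (hv : v ∈ weightSpace V μ) : ⁅x, v⁆ ∈ weightSpace V μ := by
  rw [mem_weightSpace] at hv ⊢
  rw [lie_comm_of_mem_center hx, hv, lie_smul]

theorem lie_eq_smul_iff_of_mem_center (hr : ∀ μ, Module.rank ℂ (weightSpace V μ) ≤ 1) {x y : Alg}
    (hx : x ∈ LieAlgebra.center ℂ Alg) {μ : ℂ} {v : V} (hv : v ∈ weightSpace V μ)
    (h : ⁅y, v⁆ ≠ 0) (c : ℂ) : ⁅x, v⁆ = c • v ↔ ⁅x, ⁅y, v⁆⁆ = c • ⁅y, v⁆ := by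
  have hv0 : v ≠ 0 := fun e => h (by rw [e, lie_zero])
  obtain ⟨a, ha⟩ := eq_smul_of_rank_le_one hr hv hv0 (lie_mem_weightSpace_of_mem_center hx hv)
  rw [← lie_comm_of_mem_center hx, ha, lie_smul, (smul_left_injective ℂ hv0).eq_iff,
    (smul_left_injective ℂ h).eq_iff]

theorem forall_lie_eq_smul_iff (hr : ∀ μ, Module.rank ℂ (weightSpace V μ) ≤ 1) {x : Alg} {μ : ℂ}
    {v : V} (hv : v ∈ weightSpace V μ) (hv0 : v ≠ 0) (c : ℂ) :
    (∀ w ∈ weightSpace V μ, ⁅x, w⁆ = c • w) ↔ ⁅x, v⁆ = c • v := by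
  refine ⟨fun h => h v hv, fun h w hw => ?_⟩
  obtain ⟨a, rfl⟩ := eq_smul_of_rank_le_one hr hv hv0 hw
  rw [lie_smul, h, smul_comm]

theorem exists_lie_eq_smul_of_mem_center (hI : IsIndecomposable V) (hW : IsWeightModule V)
    (hr : ∀ μ, Module.rank ℂ (weightSpace V μ) ≤ 1) {x : Alg}
    (hx : x ∈ LieAlgebra.center ℂ Alg) : ∃ c : ℂ, ∀ v : V, ⁅x, v⁆ = c • v := by
  obtain ⟨μ₀, hμ₀⟩ := exists_weightSpace_ne_bot hI hW
  obtain ⟨v₀, hv₀, h0⟩ := Submodule.exists_mem_ne_zero_of_ne_bot hμ₀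
  obtain ⟨c, hc⟩ := eq_smul_of_rank_le_one hr hv₀ h0 (lie_mem_weightSpace_of_mem_center hx hv₀)
  let A : Set ℂ := {μ | ∀ w ∈ weightSpace V μ, ⁅x, w⁆ = c • w}
  have hA (g : Gen) (μ : ℂ) (v : V) (hv : v ∈ weightSpace V μ) (h : ⁅mono g 1, v⁆ ≠ 0) :
      μ ∈ A ↔ μ + g.deg ∈ A :=
    calc _ ↔ _ := forall_lie_eq_smul_iff hr hv (fun e => h (by rw [e, lie_zero])) c
      _ ↔ _ := lie_eq_smul_iff_of_mem_center hr hx hv h c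
      _ ↔ _ := (forall_lie_eq_smul_iff hr (lie_mem_weightSpace hv g) h c).symm
  have hall (μ : ℂ) (v : V) (hv : v ∈ weightSpace V μ) : ⁅x, v⁆ = c • v := by
    obtain hbot | hbot := weightSpace_eq_bot_of_indecomposable hI hW A hA
    · exact absurd (hbot μ₀ ((forall_lie_eq_smul_iff hr hv₀ h0 c).2 hc)) hμ₀
    · refine not_not.1 fun h => h ?_
      rw [hbot μ fun hμ => h (hμ v hv), Submodule.mem_bot] at hv
      rw [hv, lie_zero, smul_zero]
  refine ⟨c, fun v => Submodule.iSup_induction (weightSpace V) (motive := fun v => ⁅x, v⁆ = c • v)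
    (hW.ge trivial) hall (by rw [lie_zero, smul_zero]) fun v w hv hw => ?_⟩
  rw [lie_add, smul_add, hv, hw]

end Weights

section Modules

variable {V : Type*} [AddCommGroup V] [Module ℂ V] [LieRingModule Alg V] [LieModule ℂ Alg V]

/-- The vectors `v t`, where nonzero, are a weight basis of `V` with structure constants `D`. -/
structure Realization (D : HVSystem) (v : ℤ → V) : Prop where
  mem : ∀ t : ℤ, v t ∈ weightSpace V (D.wt + t)
  ne_zero : ∀ t, v t ≠ 0 ↔ t ∈ D.supp
  weight : ∀ μ, weightSpace V μ ≠ ⊥ → ∃ t : ℤ, μ = D.wt + t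
  gen : ∀ t : ℤ, ∀ w ∈ weightSpace V (D.wt + t), ∃ a : ℂ, w = a • v t
  lie : ∀ g t, ⁅mono g 1, v t⁆ = D.coeff g t • v (g.deg + t)

theorem exists_coeff {wt : ℂ} {v : ℤ → V} (hv : ∀ t : ℤ, v t ∈ weightSpace V (wt + t))
    (hgen : ∀ t : ℤ, ∀ w ∈ weightSpace V (wt + t), ∃ a : ℂ, w = a • v t) (g : Gen) (t : ℤ) :
    ∃ a : ℂ, ⁅mono g 1, v t⁆ = a • v (g.deg + t) ∧
      (v t = 0 → a = 0) ∧ (v (g.deg + t) = 0 → a = 0) := by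
  have hmem : ⁅mono g 1, v t⁆ ∈ weightSpace V (wt + (g.deg + t : ℤ)) := by
    have h := lie_mem_weightSpace (hv t) g
    rwa [add_assoc, ← Int.cast_add, add_comm t] at h
  obtain ⟨a, ha⟩ := hgen _ _ hmem
  by_cases! h : v t = 0 ∨ v (g.deg + t) = 0
  · refine ⟨0, ?_, fun _ => rfl, fun _ => rfl⟩
    obtain h | h := h
    · rw [h, lie_zero, zero_smul]
    · rw [ha, h, smul_zero, smul_zero]
  · exact ⟨a, ha, fun e => absurd e h.1, fun e => absurd e h.2⟩

theorem coeff_comm_of_bracketGen {v : ℤ → V} {x : Gen → ℤ → ℂ}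
    (hx : ∀ g t, ⁅mono g 1, v t⁆ = x g t • v (g.deg + t))
    (hx0 : ∀ g t, v (g.deg + t) = 0 → x g t = 0) {g h k z : Gen} {a b c : ℂ}
    (hgh : bracketGen g h = mono k a + mono z (if g.deg + h.deg = 0 then b else 0))
    (hk : k.deg = g.deg + h.deg) (hz : ∀ u : V, ⁅mono z 1, u⁆ = c • u) {t : ℤ} (ht : v t ≠ 0) :
    x g (h.deg + t) * x h t - x h (g.deg + t) * x g t
      = a * x k t + if g.deg + h.deg = 0 then b * c else 0 := by
  have hgt : h.deg + (g.deg + t) = k.deg + t := by lia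
  have hht : g.deg + (h.deg + t) = k.deg + t := by lia
  by_cases h0 : v (k.deg + t) = 0
  · have hne : g.deg + h.deg ≠ 0 := fun e => ht (by rwa [hk, e, zero_add] at h0)
    rw [hx0 g _ (by rwa [hht]), hx0 h (g.deg + t) (by rwa [hgt]), hx0 k _ h0, if_neg hne]
    ring
  · have key := lie_lie (mono g 1) (mono h 1) (v t)
    rw [lie_mono, mul_one, one_smul, hgh, add_lie, mono_eq_smul k, mono_eq_smul z, smul_lie,
      smul_lie, hz, hx, hx h, hx g t, lie_smul, lie_smul, hx, hx, hgt, hht] at key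
    apply smul_left_injective ℂ h0
    beta_reduce
    split_ifs at key ⊢ with hdeg
    · simp only [hk, hdeg, zero_add] at key ⊢
      linear_combination (norm := module) -key
    · linear_combination (norm := module) -key

theorem exists_realization (hV : IsIntermediateSeries V) :
    ∃ (D : HVSystem) (v : ℤ → V), D.supp.Nonempty ∧ Realization D v := by
  obtain ⟨⟨hI, hW, -⟩, -, hr⟩ := hV
  obtain ⟨wt, hwt, hcoset⟩ := exists_coset hI hW
  choose v hv hgen using fun t : ℤ => exists_generator (V := V) hr (wt + t)
  choose x hx hx₁ hx₂ using exists_coeff hv hgen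
  have hcentral {g : Gen} (hg : g = .CL ∨ g = .CI ∨ g = .CLI ∨ g = .I 0) :
      ∃ c : ℂ, ∀ u : V, ⁅mono g 1, u⁆ = c • u :=
    exists_lie_eq_smul_of_mem_center hI hW hr (mono_mem_center hg)
  obtain ⟨c, hc⟩ := hcentral (g := .CL) (by simp)
  obtain ⟨k, hk⟩ := hcentral (g := .CI) (by simp)
  obtain ⟨z, hz⟩ := hcentral (g := .CLI) (by simp)
  obtain ⟨c₀, hc₀⟩ := hcentral (g := .I 0) (by simp)
  have hzero {g : Gen} {t : ℤ} {y : ℂ} (ht : v t ≠ 0) (hg : g.deg = 0)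
      (hy : ⁅mono g 1, v t⁆ = y • v t) : x g t = y := by
    apply smul_left_injective ℂ ht
    change x g t • v t = y • v t
    rw [← hy, hx, hg, zero_add]
  let D : HVSystem :=
    { supp := {t | v t ≠ 0}
      wt, c, z, k, c₀
      ℓ n t := x (.L n) t
      f n t := x (.I n) t
      normalized := hwt
      source n t h := hx₁ _ _ (not_not.1 h)
      target n t h := hx₂ (.L n) _ (not_not.1 h)
      f_source n t h := hx₁ _ _ (not_not.1 h)
      f_target n t h := hx₂ (.I n) _ (not_not.1 h)
      zero t h := hzero h rfl (mem_weightSpace.1 (hv t))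
      f_zero t h := hzero h rfl (hc₀ _)
      comm m n t h := coeff_comm_of_bracketGen hx hx₂ (g := .L m) (h := .L n) rfl rfl hc h
      LI m n t h := coeff_comm_of_bracketGen hx hx₂ (g := .L m) (h := .I n) rfl rfl hz h
      II m n t h := by
        have key := coeff_comm_of_bracketGen hx hx₂ (g := .I m) (h := .I n) (k := .I (m + n))
          (a := 0) (by rw [mono_zero, zero_add]; rfl) rfl hk h
        rwa [zero_mul, zero_add] at key }
  refine ⟨D, v, ?_, hv, fun t => Iff.rfl, hcoset, hgen, fun g t => ?_⟩
  · obtain ⟨μ, hμ⟩ := exists_weightSpace_ne_bot hI hW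
    obtain ⟨t, rfl⟩ := hcoset μ hμ
    refine ⟨t, fun h => hμ ((Submodule.eq_bot_iff _).2 fun w hw => ?_)⟩
    obtain ⟨a, rfl⟩ := hgen t w hw
    rw [h, smul_zero]
  · rcases g with n | n | _ | _ | _
    exacts [hx _ t, hx _ t, by simp [D, HVSystem.coeff, Gen.deg, hc],
      by simp [D, HVSystem.coeff, Gen.deg, hk], by simp [D, HVSystem.coeff, Gen.deg, hz]]

end Modules

theorem mem_of_sum_mem_of_mem_eigenspace {K E ι : Type*} [Field K] [AddCommGroup E] [Module K E]
    {f : Module.End K E} {p : Submodule K E} (hp : p ≤ p.comap f) {μ : ι → K}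
    (hμ : Function.Injective μ) {w : ι → E} (hw : ∀ i, w i ∈ f.eigenspace (μ i)) {s : Finset ι}
    (h : ∑ i ∈ s, w i ∈ p) {i : ι} (hi : i ∈ s) : w i ∈ p := by
  let q : Module.End K (E ⧸ p) := p.mapQ p f hp
  have hq (j : ι) : p.mkQ (w j) ∈ q.eigenspace (μ j) := by
    rw [Module.End.mem_eigenspace_iff, ← map_smul, ← Module.End.mem_eigenspace_iff.1 (hw j)]
    rfl
  have hsum : ∑ j ∈ s, p.mkQ (w j) = 0 := by
    rw [← map_sum]
    exact (Submodule.Quotient.mk_eq_zero p).2 h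
  exact (Submodule.Quotient.mk_eq_zero p).1 ((iSupIndep_iff_finsetSum_eq_zero_imp_eq_zero _).1
    (q.eigenspaces_iSupIndep.comp hμ) s _ (fun j _ => hq j) hsum i hi)

section LieModules

variable {R L M N : Type*} [CommRing R] [LieRing L] [AddCommGroup M] [Module R M]
  [LieRingModule L M] [AddCommGroup N] [Module R N] [LieRingModule L N]

/-- A bijective homomorphism of Lie modules, as an equivalence. -/
def lieModuleEquivOfBijective (φ : M →ₗ⁅R,L⁆ N) (h : Function.Bijective φ) : M ≃ₗ⁅R,L⁆ N :=
  { LinearEquiv.ofBijective (φ : M →ₗ[R] N) h, φ with }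

theorem isIrreducible_of_equiv (e : M ≃ₗ⁅R,L⁆ N) (h : LieModule.IsIrreducible R L M) :
    LieModule.IsIrreducible R L N :=
  have : IsSimpleOrder (LieSubmodule R L M) := h
  (LieSubmodule.orderIsoMapComap e).symm.isSimpleOrder

theorem isTrivial_of_injective (φ : M →ₗ⁅R,L⁆ N) (hφ : Function.Injective φ)
    [LieModule.IsTrivial L N] : LieModule.IsTrivial L M :=
  ⟨fun x m => hφ (by rw [LieModuleHom.map_lie, trivial_lie_zero]; exact (map_zero φ).symm)⟩

variable [LieAlgebra R L] [LieModule R L M]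

/-- The first isomorphism theorem for a surjective homomorphism of Lie modules. -/
def quotKerEquivOfSurjective (φ : M →ₗ⁅R,L⁆ N) (hφ : Function.Surjective φ) :
    (M ⧸ φ.ker) ≃ₗ⁅R,L⁆ N :=
  { (φ : M →ₗ[R] N).quotKerEquivOfSurjective hφ with
    map_lie' := fun {x m} => by
      induction m using Submodule.Quotient.induction_on with
      | _ m => exact LieModuleHom.map_lie φ x m }

end LieModules

theorem isNontrivialSimpleSubquotient_of_surjective {V : Type*} [AddCommGroup V] [Module ℂ V]
    [LieRingModule Alg V] {M : Type} [AddCommGroup M] [Module ℂ M] [LieRingModule Alg M]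
    [LieModule ℂ Alg M] (hirr : LieModule.IsIrreducible ℂ Alg V)
    (htriv : ¬ LieModule.IsTrivial Alg V) (φ : M →ₗ⁅ℂ,Alg⁆ V) (hφ : Function.Surjective φ) :
    IsNontrivialSimpleSubquotient V M := by
  let ψ : (⊤ : LieSubmodule ℂ Alg M) →ₗ⁅ℂ,Alg⁆ V := φ.comp (LieSubmodule.incl ⊤)
  have hψ : Function.Surjective ψ := fun x => (hφ x).imp' (⟨·, trivial⟩) fun _ h => h
  let e := (quotKerEquivOfSurjective ψ hψ).symm
  exact ⟨⊤, ψ.ker, isIrreducible_of_equiv e hirr,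
    fun _ => htriv (isTrivial_of_injective e.toLieModuleHom e.injective), ⟨e⟩⟩

/-- The action of all basis elements of the algebra on `Mod C`, on which the centre acts by zero. -/
def Coeffs.coeff (C : Coeffs) : Gen → ℤ → ℂ
  | .L n, t => C.ℓ n t
  | .I n, t => C.f n t
  | _, _ => 0

theorem actGen_eq_vec (C : Coeffs) (g : Gen) (t : ℤ) :
    actGen C g t = vec C (g.deg + t) (C.coeff g t) := by
  rcases g with _ | _ | _ | _ | _
  exacts [rfl, rfl, (vec_zero ..).symm, (vec_zero ..).symm, (vec_zero ..).symm]

theorem injective_add_intCast (μ : ℂ) : Function.Injective fun t : ℤ => μ + t :=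
  (add_right_injective μ).comp Int.cast_injective

namespace HVSystem

variable {D : HVSystem}

theorem coeff_mul (D : HVSystem) (s : ℤ → ℂˣ) (g : Gen) (t : ℤ) :
    D.coeff g t * s t = s (g.deg + t) * (D.rescale s).coeff g t := by
  have hcentral (x : ℂ) : x * s t = s (0 + t) * x := by rw [zero_add, mul_comm]
  rcases g with _ | _ | _ | _ | _
  exacts [conj_eq_iff.1 rfl, conj_eq_iff.1 rfl, hcentral _, hcentral _, hcentral _]

theorem IsModel.exists_coeff_rescale_eq {p : Param} (h : D.IsModel p) :
    ∃ s, (D.rescale s).coeff = p.coeffs.coeff := by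
  obtain ⟨-, hc, hz, hk, s, hℓ, hf⟩ := h
  refine ⟨s, funext fun g => funext fun t => ?_⟩
  rcases g with n | n | _ | _ | _
  exacts [conj_eq_iff.2 (hℓ n t trivial trivial), conj_eq_iff.2 (hf n t trivial trivial), hc, hk,
    hz]

end HVSystem

section Modules

variable {V : Type*} [AddCommGroup V] [Module ℂ V] [LieRingModule Alg V] [LieModule ℂ Alg V]

/-- The homomorphism `Mod C → V` taking `v_t` to `w t`, for a family `w` on which the algebra acts
through the structure constants `C`. -/
def homOfFamily (C : Coeffs) (w : ℤ → V)
    (hw : ∀ g t, ⁅mono g 1, w t⁆ = C.coeff g t • w (g.deg + t)) : Mod C →ₗ⁅ℂ,Alg⁆ V where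
  toLinearMap := (Finsupp.linearCombination ℂ w : (ℤ →₀ ℂ) →ₗ[ℂ] V)
  map_lie' {x m} := by
    let φ : Mod C →ₗ[ℂ] V := (Finsupp.linearCombination ℂ w : (ℤ →₀ ℂ) →ₗ[ℂ] V)
    have hφ (t : ℤ) (z : ℂ) : φ (vec C t z) = z • w t := Finsupp.linearCombination_single ℂ z t
    change φ ⁅x, m⁆ = ⁅x, φ m⁆
    induction x using alg_induction with
    | h0 => rw [zero_lie, zero_lie, map_zero]
    | ha x y hx hy => rw [add_lie, add_lie, map_add, hx, hy]
    | hs g a =>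
      induction m using mod_induction C with
      | h0 => rw [lie_zero, map_zero, lie_zero]
      | ha m n hm hn => rw [lie_add, map_add, map_add, lie_add, hm, hn]
      | hs t b =>
        rw [act_mono, map_smul, hφ, mono_eq_smul, smul_lie, lie_smul, smul_smul, hw,
          actGen_eq_vec, hφ]

namespace Realization

variable {D : HVSystem} {v : ℤ → V}

theorem rescale (R : Realization D v) (s : ℤ → ℂˣ) :
    Realization (D.rescale s) fun t => (s t : ℂ) • v t where
  mem t := Submodule.smul_mem _ _ (R.mem t)
  ne_zero t := (smul_ne_zero_iff_right (s t).ne_zero).trans (R.ne_zero t)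
  weight := R.weight
  gen t w hw := by
    obtain ⟨a, rfl⟩ := R.gen t w hw
    exact ⟨a * (s t)⁻¹, by rw [smul_smul, mul_assoc, Units.inv_mul, mul_one]⟩
  lie g t := by
    rw [lie_smul, R.lie, smul_smul, smul_smul, mul_comm, D.coeff_mul s, mul_comm]

theorem span (R : Realization D v) (hW : IsWeightModule V) :
    Submodule.span ℂ (Set.range v) = ⊤ := by
  have hsup : ⨆ μ, weightSpace V μ = ⊤ := hW
  refine eq_top_iff.2 (hsup ▸ iSup_le fun μ w hw => ?_)
  by_cases hμ : weightSpace V μ = ⊥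
  · rw [hμ, Submodule.mem_bot] at hw
    exact hw ▸ zero_mem _
  · obtain ⟨t, rfl⟩ := R.weight μ hμ
    obtain ⟨a, rfl⟩ := R.gen t w hw
    exact Submodule.smul_mem _ _ (Submodule.subset_span ⟨t, rfl⟩)

theorem surjective_homOfFamily (R : Realization D v) (hW : IsWeightModule V) {C : Coeffs}
    (hv : ∀ g t, ⁅mono g 1, v t⁆ = C.coeff g t • v (g.deg + t)) :
    Function.Surjective (homOfFamily C v hv) :=
  LinearMap.range_eq_top.1 ((Finsupp.range_linearCombination ℂ).trans (R.span hW))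

theorem linearIndependent (R : Realization D v) (hS : D.supp = Set.univ) :
    LinearIndependent ℂ v :=
  Module.End.eigenvectors_linearIndependent' (LieModule.toEnd ℂ Alg V (mono (.L 0) 1))
    (fun t : ℤ => D.wt + t) (injective_add_intCast D.wt) v
    fun t => ⟨R.mem t, (R.ne_zero t).2 (hS ▸ trivial)⟩

theorem nonempty_equiv (R : Realization D v) (hW : IsWeightModule V) {p : Param}
    (h : D.IsModel p) : Nonempty (V ≃ₗ⁅ℂ,Alg⁆ Series p) := by
  obtain ⟨s, hs⟩ := h.exists_coeff_rescale_eq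
  have R' := R.rescale s
  have hv := R'.lie
  rw [hs] at hv
  exact ⟨(lieModuleEquivOfBijective (homOfFamily p.coeffs _ hv)
    ⟨R'.linearIndependent h.1, R'.surjective_homOfFamily hW hv⟩).symm⟩

theorem isTrivial_of_coeff_eq_zero (R : Realization D v) (hW : IsWeightModule V)
    (h : D.coeff = 0) : LieModule.IsTrivial Alg V := by
  have hzero (g : Gen) (w : V) : ⁅mono g 1, w⁆ = 0 := by
    refine LinearMap.congr_fun (f := LieModule.toEnd ℂ Alg V (mono g 1)) (g := 0)
      (LinearMap.ext_on_range (R.span hW) fun t => ?_) w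
    change ⁅mono g 1, v t⁆ = 0
    rw [R.lie, h]
    exact zero_smul ℂ _
  refine ⟨fun x w => ?_⟩
  induction x using alg_induction with
  | h0 => exact zero_lie w
  | ha x y hx hy => rw [add_lie, hx, hy, add_zero]
  | hs g a => rw [mono_eq_smul, smul_lie, hzero, smul_zero]

theorem disjoint_or_supp_subset (R : Realization D v) (hI : IsIndecomposable V)
    (hW : IsWeightModule V) (A : Set ℤ)
    (hA : ∀ g t, D.coeff g t ≠ 0 → (t ∈ A ↔ g.deg + t ∈ A)) :
    Disjoint A D.supp ∨ D.supp ⊆ A := by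
  let wt (t : ℤ) : ℂ := D.wt + t
  have hwt {t : ℤ} : wt t ∈ wt '' A ↔ t ∈ A := (injective_add_intCast D.wt).mem_set_image
  have hne {t : ℤ} (ht : t ∈ D.supp) : weightSpace V (wt t) ≠ ⊥ := fun h =>
    (R.ne_zero t).2 ht ((Submodule.mem_bot ℂ).1 (h ▸ R.mem t))
  refine (weightSpace_eq_bot_of_indecomposable hI hW (wt '' A) fun g μ w hw hgw => ?_).imp
    (fun h => Set.disjoint_left.2 fun t ht hS => hne hS (h _ ⟨t, ht, rfl⟩))
    fun h t ht => by_contra fun htA => hne ht (h _ (hwt.not.2 htA))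
  obtain ⟨t, rfl⟩ := R.weight μ ((Submodule.ne_bot_iff _).2
    ⟨w, hw, fun e => hgw (by rw [e, lie_zero])⟩)
  obtain ⟨a, rfl⟩ := R.gen t w hw
  rw [lie_smul, R.lie] at hgw
  have hshift : D.wt + t + g.deg = wt (g.deg + t) := by
    simp only [wt, Int.cast_add]
    ring
  rw [hshift]
  exact hwt.trans ((hA g t (left_ne_zero_of_smul (right_ne_zero_of_smul hgw))).trans hwt.symm)

theorem not_isSplit (R : Realization D v) (hI : IsIndecomposable V) (hW : IsWeightModule V) :
    ¬ D.IsSplit := by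
  rintro ⟨hS, h⟩
  have hiff {n t : ℤ} {x : ℂ} (h₀ : t = 0 → x = 0) (h₁ : t = -n → x = 0) (hx : x ≠ 0) :
      t ∈ ({0} : Set ℤ) ↔ n + t ∈ ({0} : Set ℤ) :=
    iff_of_false (fun e => hx (h₀ e)) fun e => hx (h₁ (neg_eq_of_add_eq_zero_right e).symm)
  have hA : ∀ g t, D.coeff g t ≠ 0 → (t ∈ ({0} : Set ℤ) ↔ g.deg + t ∈ ({0} : Set ℤ)) := by
    rintro (n | n | _ | _ | _) t hx
    · exact hiff (fun e => e ▸ (h n).1.1) (fun e => e ▸ (h n).2.1) hx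
    · exact hiff (fun e => e ▸ (h n).1.2) (fun e => e ▸ (h n).2.2) hx
    all_goals simp only [Gen.deg, zero_add]
  obtain h' | h' := R.disjoint_or_supp_subset hI hW {0} hA
  · exact Set.disjoint_left.1 h' rfl (hS ▸ trivial)
  · exact one_ne_zero (h' (hS ▸ trivial : (1 : ℤ) ∈ D.supp))

theorem exists_mem_of_ne_bot (R : Realization D v) (hW : IsWeightModule V)
    {N : LieSubmodule ℂ Alg V} (hN : N ≠ ⊥) : ∃ t ∈ D.supp, v t ∈ N := by
  obtain ⟨x, hx, hx0⟩ : ∃ x ∈ N, x ≠ 0 := by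
    by_contra! h
    exact hN ((LieSubmodule.eq_bot_iff N).2 h)
  obtain ⟨a, rfl⟩ : ∃ a : ℤ →₀ ℂ, Finsupp.linearCombination ℂ v a = x := by
    rw [← LinearMap.mem_range, Finsupp.range_linearCombination, R.span hW]
    trivial
  rw [Finsupp.linearCombination_apply, Finsupp.sum] at hx hx0
  obtain ⟨t, ht, hat⟩ := Finset.exists_ne_zero_of_sum_ne_zero hx0
  have hmem : a t • v t ∈ N.toSubmodule :=
    mem_of_sum_mem_of_mem_eigenspace (f := LieModule.toEnd ℂ Alg V (mono (.L 0) 1))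
      (fun _ => N.lie_mem) (injective_add_intCast D.wt)
      (fun t => Submodule.smul_mem _ _ (R.mem t)) hx ht
  exact ⟨t, (R.ne_zero t).1 (right_ne_zero_of_smul hat),
    (N.toSubmodule.smul_mem_iff (left_ne_zero_of_smul hat)).1 hmem⟩

theorem lie_of_puncturedForm (R : Realization D v) (h : D.PuncturedForm) (h0 : 0 ∉ D.supp)
    (g : Gen) (t : ℤ) :
    ⁅mono g 1, v t⁆ = (Param.A 0 0 0).coeffs.coeff g t • v (g.deg + t) := by
  have hv0 : v 0 = 0 := not_not.1 ((R.ne_zero 0).not.2 h0)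
  obtain rfl | ht := eq_or_ne t 0
  · rcases g with _ | _ | _ | _ | _ <;>
      simp [hv0, Param.coeffs, coeffsA, Coeffs.coeff]
  obtain hgt | hgt := eq_or_ne (g.deg + t) 0
  · rw [R.lie, hgt, hv0, smul_zero, smul_zero]
  rw [R.lie]
  congr 1
  rcases g with n | n | _ | _ | _
  · exact (h.ℓ_eq n t ht hgt).trans (by simp [Param.coeffs, coeffsA, Coeffs.coeff])
  exacts [h.f_eq_zero (h.c₀_eq_zero_of_zero_notMem h0) ht hgt, h.c, h.k_eq_zero, h.z_eq_zero]

theorem isIrreducible_of_puncturedForm (R : Realization D v) (hI : IsIndecomposable V)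
    (hW : IsWeightModule V) (h : D.PuncturedForm) (h0 : 0 ∉ D.supp) :
    LieModule.IsIrreducible ℂ Alg V := by
  have := hI.1
  refine LieModule.IsIrreducible.mk fun N hN => ?_
  obtain ⟨t, ht, htN⟩ := R.exists_mem_of_ne_bot hW hN
  have ht0 : (t : ℂ) ≠ 0 := Int.cast_ne_zero.2 fun e => h0 (e ▸ ht)
  rw [← LieSubmodule.toSubmodule_eq_top, eq_top_iff, ← R.span hW, Submodule.span_le]
  rintro _ ⟨r, rfl⟩
  have hr : ⁅mono (.L (r - t)) 1, v t⁆ = (t : ℂ) • v r := by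
    rw [R.lie_of_puncturedForm h h0]
    simp [Param.coeffs, coeffsA, Coeffs.coeff, Gen.deg]
  exact (N.toSubmodule.smul_mem_iff ht0).1 (hr ▸ N.lie_mem htN)

theorem exists_surjective_of_puncturedForm (R : Realization D v) (hW : IsWeightModule V)
    (h : D.PuncturedForm) (h0 : 0 ∉ D.supp) :
    ∃ φ : Series (.A 0 0 0) →ₗ⁅ℂ,Alg⁆ V, Function.Surjective φ :=
  ⟨_, R.surjective_homOfFamily hW (R.lie_of_puncturedForm h h0)⟩

end Realization

end Modules

end TwistedHV

end

theorem theorem3p6 (V : Type*) [AddCommGroup V] [Module ℂ V] [LieRingModule TwistedHV.Alg V]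
    [LieModule ℂ TwistedHV.Alg V] (hV : TwistedHV.IsIntermediateSeries V) :
    (LieModule.IsIrreducible ℂ TwistedHV.Alg V →
      (∃ p : TwistedHV.Param, LieModule.IsIrreducible ℂ TwistedHV.Alg (TwistedHV.Series p) ∧
        Nonempty (V ≃ₗ⁅ℂ,TwistedHV.Alg⁆ TwistedHV.Series p)) ∨
      (∃ p : TwistedHV.Param,
        TwistedHV.IsNontrivialSimpleSubquotient V (TwistedHV.Series p))) ∧
    (¬ LieModule.IsIrreducible ℂ TwistedHV.Alg V →
      ∃ p : TwistedHV.Param, Nonempty (V ≃ₗ⁅ℂ,TwistedHV.Alg⁆ TwistedHV.Series p)) := by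
  obtain ⟨D, v, hne, R⟩ := TwistedHV.exists_realization hV
  obtain ⟨⟨hI, hW, -⟩, htriv, -⟩ := hV
  obtain hzero | ⟨p, hp⟩ | ⟨s, hs, h0⟩ | hsplit := TwistedHV.HVSystem.classify hne
  · exact absurd (R.isTrivial_of_coeff_eq_zero hW hzero) htriv
  · obtain ⟨e⟩ := R.nonempty_equiv hW hp
    exact ⟨fun hirr => .inl ⟨p, TwistedHV.isIrreducible_of_equiv e hirr, ⟨e⟩⟩, fun _ => ⟨p, ⟨e⟩⟩⟩
  · have hirr := (R.rescale s).isIrreducible_of_puncturedForm hI hW hs h0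
    obtain ⟨φ, hφ⟩ := (R.rescale s).exists_surjective_of_puncturedForm hW hs h0
    exact ⟨fun _ => .inr
      ⟨_, TwistedHV.isNontrivialSimpleSubquotient_of_surjective hirr htriv φ hφ⟩,
      fun hred => absurd hirr hred⟩
  · exact absurd hsplit (R.not_isSplit hI hW)
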